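/- Let $n,m,p\ge 1$, $1\le r\le K\le \min(m,p)$, $\sigma>0$, $\alpha\in(0,1)$, $a>0$, $B>0$, $C>0$. Model. For $M\in\mathbb R^{m\times p}$ let $P_M$ be the law of $((i,j),Y)$ with $(i,j)$ uniform on $\{1,\dots,m\}\times\{1,\dots,p\}$ and $Y=M_{i,j}+\xi$, where $\xi\sim\mathcal N(0,\sigma^2)$ is independent of $(i,j)$. The sample $X_1^n=(X_1,\dots,X_n)$ is i.i.d. from $P_{M_0}$; $L_n(M)$ denotes the likelihood. Prior. $\theta=(\gamma,U,V)$ with $\gamma\in(0,\infty)^K$, $U\in\mathbb R^{m\times K}$, $V\in\mathbb R^{p\times K}$. Under $\pi$, the $1/\gamma_k$ are i.i.d. $\Gamma(a,b)$ ($b$ is the rate), and given $\gamma$ all the entries $U_{i,k}$, $V_{j,k}$ are independent with law $\mathcal N(0,\gamma_k)$. Here $b=B^2/\{512\,(nmp)^4[\max(m,p)K]^2\}$. Put $M=UV^t$. VB approximation. Let $\pi_{n,\alpha}(d\theta|X_1^n)\propto L_n(UV^t)^\alpha\,\pi(d\theta)$ and let $\mathcal F$ be the set of all probability distributions $\bigotimes_{i=1}^m\rho_{U_i}(dU_{i,\cdot})\bigotimes_{j=1}^p\rho_{V_j}(dV_{j,\cdot})\bigotimes_{k=1}^K\rho_{\gamma_k}(d\gamma_k)$.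 Let $\tilde\pi_{n,\alpha}(\cdot|X_1^n)$ be any minimizer of the Kullback-Leibler divergence $\rho\mapsto\mathcal K(\rho,\pi_{n,\alpha}(\cdot|X_1^n))$ over $\mathcal F$. Assume $M_0=\bar U\bar V^t$ where $\bar U\in\mathbb R^{m\times K}$ and $\bar V\in\mathbb R^{p\times K}$ have all entries bounded by $B$ in absolute value and $\bar U_{i,\ell}=\bar V_{j,\ell}=0$ for $\ell>r$, and assume $\max_{i,j}|(M_0)_{i,j}|\le C$. Let $\mathrm{clip}_C(M)$ be the matrix with entries $\min(\max(M_{i,j},-C),C)$, and let $\mathcal C(a)=\log(8\sqrt\pi\,\Gamma(a)2^{10a+1})+3$. Then $$\mathbb E\left[\int \frac{\|\mathrm{clip}_C(M)-M_0\|_F^2}{mp}\,\tilde\pi_{n,\alpha}(dM|X_1^n)\right]\le\frac{8C^2(1+\alpha)(1+2a)\,r(m+p)\left[\log(nmp)+\mathcal C(a)+\frac{\alpha B}{2\sigma^2mp}\max\left\{1,\left(\frac{B}{nmp}\right)^3\right\}\right]}{n\left[1-\exp\left(2C^2\alpha(\alpha-1)/\sigma^2\right)\right]}.$$ In particular, for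 $B\le nmp$ the term in $B$ is $\frac{\alpha B}{2\sigma^2mp}$. -/

import Mathlib

open MeasureTheory ProbabilityTheory
open scoped ENNReal NNReal Matrix

namespace MatrixCompletionVB

noncomputable section

/-! ### The model -/

/-- One observation: a position `(i, j)` together with a noisy value of that entry. -/
abbrev Obs (m p : ℕ) : Type := (Fin m × Fin p) × ℝ

/-- The law `P_M` of one observation `((i, j), Y)`: the position is uniform, the noise `ξ` is
independent of it with law `N(0, σ²)`, and `Y = M i j + ξ`. -/
def obsLaw {m p : ℕ} (σ : ℝ) (M : Matrix (Fin m) (Fin p) ℝ) : Measure (Obs m p) :=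
  ((uniformOn (Set.univ : Set (Fin m × Fin p))).prod
      (gaussianReal 0 (Real.toNNReal (σ ^ 2)))).map
    (fun z => (z.1, M z.1.1 z.1.2 + z.2))

/-- The law of an i.i.d. sample of size `n` from `P_M`. -/
def sampleLaw {m p : ℕ} (n : ℕ) (σ : ℝ) (M : Matrix (Fin m) (Fin p) ℝ) :
    Measure (Fin n → Obs m p) :=
  Measure.pi fun _ => obsLaw σ M

/-- The log-likelihood of `M`, with densities taken with respect to the product of the uniform
law of the position and Lebesgue measure. -/
def logLikelihood {m p n : ℕ} (σ : ℝ) (x : Fin n → Obs m p) (M : Matrix (Fin m) (Fin p) ℝ) : ℝ :=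
  ∑ k, Real.log (gaussianPDFReal (M (x k).1.1 (x k).1.2) (Real.toNNReal (σ ^ 2)) (x k).2)

/-! ### Parameters and prior -/

/-- Parameters `(γ, (U, V))`: the vector `γ` of variances, `U` of size `m × K` and `V` of size
`p × K`, both given by their rows. -/
abbrev Param (m p K : ℕ) : Type :=
  (Fin K → ℝ) × ((Fin m → Fin K → ℝ) × (Fin p → Fin K → ℝ))

/-- The matrix `U Vᵗ`. -/
def Param.toMatrix {m p K : ℕ} (θ : Param m p K) : Matrix (Fin m) (Fin p) ℝ :=
  Matrix.of θ.2.1 * (Matrix.of θ.2.2)ᵀ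

/-- The inverse gamma law: the law of `γ` when `1/γ` is `Γ(a, b)` distributed (`b` is a rate). -/
def invGammaMeasure (a b : ℝ) : Measure ℝ :=
  (gammaMeasure a b).map (fun x => x⁻¹)

theorem measurable_measure_pi {ι α : Type*} [Fintype ι] {β : ι → Type*} [MeasurableSpace α]
    [∀ i, MeasurableSpace (β i)] (κ : ∀ i, α → Measure (β i))
    [∀ i a, IsProbabilityMeasure (κ i a)] (h : ∀ i, Measurable (κ i)) :
    Measurable fun a => Measure.pi fun i => κ i a := by
  refine Measurable.measure_of_isPiSystem_of_isProbabilityMeasure generateFrom_pi.symm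
    isPiSystem_pi ?_
  rintro _ ⟨t, ht, rfl⟩
  simp only [Measure.pi_pi]
  refine Finset.measurable_prod _ fun i _ => ?_
  exact (Measure.measurable_coe (ht i (Set.mem_univ i))).comp (h i)

/-- Given `γ`, the entries `U i k` of a matrix with `d` rows are independent, with law
`N(0, γ k)`. -/
def gaussianRows (d K : ℕ) : Kernel (Fin K → ℝ) (Fin d → Fin K → ℝ) where
  toFun γ := Measure.pi fun _ => Measure.pi fun k => gaussianReal 0 (Real.toNNReal (γ k))
  measurable' := by
    refine measurable_measure_pi (fun (_ : Fin d) (γ : Fin K → ℝ) =>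
      Measure.pi fun k => gaussianReal 0 (Real.toNNReal (γ k))) fun _ => ?_
    refine measurable_measure_pi (fun (k : Fin K) (γ : Fin K → ℝ) =>
      gaussianReal 0 (Real.toNNReal (γ k))) fun k => ?_
    exact measurable_gaussianReal.comp
      (measurable_const.prodMk (measurable_real_toNNReal.comp (measurable_pi_apply k)))

/-- The prior: the `γ k` are i.i.d. inverse gamma; given `γ`, the entries of `U` and `V` are
independent, `U i k` and `V j k` having law `N(0, γ k)`. -/
def prior (m p K : ℕ) (a b : ℝ) : Measure (Param m p K) :=
  (Measure.pi fun _ : Fin K => invGammaMeasure a b) ⊗ₘ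
    ((gaussianRows m K) ×ₖ (gaussianRows p K))

/-! ### Fractional posterior and variational approximation -/

/-- The fractional posterior, proportional to `L_n(θ) ^ α π(dθ)`. -/
def fracPosterior {m p n : ℕ} (K : ℕ) (a b σ α : ℝ) (x : Fin n → Obs m p) :
    Measure (Param m p K) :=
  (prior m p K a b).tilted fun θ => α * logLikelihood σ x θ.toMatrix

/-- The mean-field family: the rows of `U`, the rows of `V` and the `γ k` are all independent. -/
def meanField (m p K : ℕ) : Set (Measure (Param m p K)) :=
  {ρ | ∃ (ρU : Fin m → Measure (Fin K → ℝ)) (ρV : Fin p → Measure (Fin K → ℝ))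
      (ργ : Fin K → Measure ℝ),
      (∀ i, IsProbabilityMeasure (ρU i)) ∧ (∀ j, IsProbabilityMeasure (ρV j)) ∧
      (∀ k, IsProbabilityMeasure (ργ k)) ∧
      ρ = (Measure.pi ργ).prod ((Measure.pi ρU).prod (Measure.pi ρV))}

/-- `ρ` is a variational Bayes approximation of the fractional posterior: it minimizes the
Kullback-Leibler divergence `K(·, π_{n,α}(·|x))` over the mean-field family. -/
def IsVBApprox {m p n K : ℕ} (a b σ α : ℝ) (x : Fin n → Obs m p) (ρ : Measure (Param m p K)) :
    Prop :=
  IsMinOn (fun ρ' => InformationTheory.klDiv ρ' (fracPosterior K a b σ α x)) (meanField m p K) ρ ∧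
    ρ ∈ meanField m p K

/-! ### Quantities in the bound -/

/-- The pairs of matrices of sizes `m × K` and `p × K` whose columns after the first `r` vanish
and whose entries are bounded by `B` in absolute value. -/
def factorClass (m p K r : ℕ) (B : ℝ) :
    Set (Matrix (Fin m) (Fin K) ℝ × Matrix (Fin p) (Fin K) ℝ) :=
  {W | (∀ i (l : Fin K), r ≤ (l : ℕ) → W.1 i l = 0) ∧ (∀ i l, |W.1 i l| ≤ B) ∧
      (∀ j (l : Fin K), r ≤ (l : ℕ) → W.2 j l = 0) ∧ (∀ j l, |W.2 j l| ≤ B)}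

/-- Entrywise clipping to `[-C, C]`. -/
def clip {m p : ℕ} (C : ℝ) (M : Matrix (Fin m) (Fin p) ℝ) : Matrix (Fin m) (Fin p) ℝ :=
  Matrix.of fun i j => min (max (M i j) (-C)) C

/-- The squared Frobenius norm. -/
def frobeniusSq {m p : ℕ} (M : Matrix (Fin m) (Fin p) ℝ) : ℝ :=
  ∑ i, ∑ j, (M i j) ^ 2

/-- The constant `𝒞(a)`. -/
def constC (a : ℝ) : ℝ :=
  Real.log (8 * √Real.pi * Real.Gamma a * 2 ^ (10 * a + 1)) + 3

/-- The value of the prior parameter `b`. -/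
def bChoice (n m p K : ℕ) (B : ℝ) : ℝ :=
  B ^ 2 / (512 * ((n : ℝ) * m * p) ^ 4 * (((max m p : ℕ) : ℝ) * K) ^ 2)

end

end MatrixCompletionVB

/-! The argument is PAC-Bayesian and runs for each fixed sample before averaging. Write `ℓ` for the
log-likelihood, `ρ` for the variational approximation, `π` for the prior, and let `g` be the clipped
loss times `n * curv C c`, with `c = α(1-α)/(2σ²)`. The Donsker-Varadhan inequality against the
fractional posterior bounds `∫ g dρ` by the divergence of `ρ` plus the log of an exponential moment.
Since `ρ` minimizes the divergence, any mean-field law `ρ'` may replace it there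
(`integral_le_of_klDiv_tilted_le`). The normalizing constant cancels, leaving `K(ρ', π) - α ∫ ℓ dρ'
+ log ∫ exp(α ℓ + g) dπ`.

After centring by `α ℓ(M₀)`, the log is at most the moment minus one, and the moment has expectation
at most one by Fubini (`lintegral_exp_moment_le_one`). Indeed one observation has `E exp(α(ℓ(M) -
ℓ(M₀)))` equal to the mean over the entries of `exp(-c (M - M₀)²)`, and a chord bound for `1 -
exp(-c t)` on `[0, 4C²]` compares this with the clipped loss (`mean_exp_le`). That chord is the
source of the denominator `1 - exp(2C²α(α-1)/σ²)`.

It remains to choose `ρ'` close to the prior and concentrated near `M₀` (`exists_reference`). Its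
rows are Gaussian, centred at the rows of the given factors, so `UVᵗ` has mean exactly `M₀` and the
likelihood term reduces to a mean squared error. Each `γ k` follows the prior conditioned on a short
interval: `[B², 2B²]` for the first `r` columns, and an interval ending at `b` with relative width
of order `1/(m+p)` for the null columns. A null column therefore costs only about `log(m+p)`,
although it has `m+p` entries. The signal variance carries a factor `m+p` whose logarithm pays for
all the null columns (`divergence_arith`). -/

namespace MatrixCompletionVB

/-! ### Variational inequalities for tilted measures -/

section Gibbs

variable {Θ : Type*} [MeasurableSpace Θ]

theorem integrable_of_abs_le {μ : Measure Θ} [IsFiniteMeasure μ] {g : Θ → ℝ} {c : ℝ}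
    (hg : Measurable g) (hc : ∀ θ, |g θ| ≤ c) : Integrable g μ :=
  Integrable.of_bound hg.aestronglyMeasurable c (Filter.Eventually.of_forall hc)

/-- The Donsker-Varadhan inequality for bounded functions. -/
theorem integral_le_toReal_klDiv_add_log {μ ρ : Measure Θ} [IsProbabilityMeasure μ]
    [IsProbabilityMeasure ρ] {g : Θ → ℝ} {c : ℝ} (hg : Measurable g) (hc : ∀ θ, |g θ| ≤ c)
    (hρ : InformationTheory.klDiv ρ μ ≠ ∞) :
    ∫ θ, g θ ∂ρ ≤ (InformationTheory.klDiv ρ μ).toReal + Real.log (∫ θ, Real.exp (g θ) ∂μ) := by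
  obtain ⟨hac, hint⟩ := InformationTheory.klDiv_ne_top_iff.1 hρ
  have hexp : Integrable (fun θ => Real.exp (g θ)) μ := by
    refine integrable_of_abs_le (c := Real.exp c) hg.exp fun θ => ?_
    rw [abs_of_pos (Real.exp_pos _)]
    exact Real.exp_le_exp.2 ((le_abs_self _).trans (hc θ))
  have hpt : IsProbabilityMeasure (μ.tilted g) := isProbabilityMeasure_tilted hexp
  have h1 := integral_llr_tilted_right hac (integrable_of_abs_le hg hc) hexp hint
  have h2 := InformationTheory.toReal_klDiv_of_measure_eq
    (hac.trans (absolutelyContinuous_tilted hexp)) (by simp : ρ Set.univ = μ.tilted g Set.univ)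
  have h3 := InformationTheory.toReal_klDiv_of_measure_eq hac (by simp : ρ Set.univ = μ Set.univ)
  -- The gap in the inequality is exactly the divergence of `ρ` from the tilted measure.
  have h4 : 0 ≤ (InformationTheory.klDiv ρ (μ.tilted g)).toReal := ENNReal.toReal_nonneg
  linarith

/-- If `ρ` is closer than `ρ'` to the tilted measure, integrals of bounded functions against `ρ`
are controlled by quantities that only depend on `ρ'`. -/
theorem integral_le_of_klDiv_tilted_le {μ ρ ρ' : Measure Θ} [IsProbabilityMeasure μ]
    [IsProbabilityMeasure ρ] [IsProbabilityMeasure ρ'] {f g : Θ → ℝ} {c : ℝ}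
    (hf : Integrable (fun θ => Real.exp (f θ)) μ) (hg : Measurable g) (hc : ∀ θ, |g θ| ≤ c)
    (hac : ρ' ≪ μ) (hint : Integrable (llr ρ' μ) ρ') (hfρ : Integrable f ρ')
    (hle : InformationTheory.klDiv ρ (μ.tilted f) ≤ InformationTheory.klDiv ρ' (μ.tilted f)) :
    ∫ θ, g θ ∂ρ ≤ ∫ θ, llr ρ' μ θ ∂ρ' - ∫ θ, f θ ∂ρ'
      + Real.log (∫ θ, Real.exp (f θ + g θ) ∂μ) := by
  have hpt : IsProbabilityMeasure (μ.tilted f) := isProbabilityMeasure_tilted hf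
  have hac' : ρ' ≪ μ.tilted f := hac.trans (absolutelyContinuous_tilted hf)
  have hfin : InformationTheory.klDiv ρ' (μ.tilted f) ≠ ∞ :=
    InformationTheory.klDiv_ne_top hac' (integrable_llr_tilted_right hac hfρ hint hf)
  -- Finiteness of the divergence of `ρ` is inherited from `ρ'`; nothing else is required of the
  -- minimizer.
  have h1 := integral_le_toReal_klDiv_add_log hg hc (ne_top_of_le_ne_top hfin hle)
  have h2 := ENNReal.toReal_mono hfin hle
  rw [InformationTheory.toReal_klDiv_of_measure_eq hac' (by simp),
    integral_llr_tilted_right hac hfρ hf hint] at h2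
  have hexp : Integrable (fun θ => Real.exp (f θ + g θ)) μ := by
    simp_rw [Real.exp_add]
    refine hf.mul_bdd (c := Real.exp c) hg.exp.aestronglyMeasurable
      (Filter.Eventually.of_forall fun θ => ?_)
    rw [Real.norm_of_nonneg (Real.exp_pos _).le]
    exact Real.exp_le_exp.2 ((le_abs_self _).trans (hc θ))
  -- `log ∫ exp f dμ` enters `h1` with a minus sign and `h2` with a plus sign, so it cancels.
  rw [integral_exp_tilted, Real.log_div] at h1
  · simp only [Pi.add_apply] at h1
    linarith
  · exact (integral_exp_pos hexp).ne'
  · exact (integral_exp_pos hf).ne'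

end Gibbs

/-! ### Densities of product measures -/

section Density

theorem lintegral_pi_prod {ι : Type*} [Fintype ι] {X : ι → Type*} [∀ i, MeasurableSpace (X i)]
    (μ : ∀ i, Measure (X i)) [∀ i, IsProbabilityMeasure (μ i)] {f : ∀ i, X i → ℝ≥0∞}
    (hf : ∀ i, Measurable (f i)) :
    ∫⁻ x, ∏ i, f i (x i) ∂Measure.pi μ = ∏ i, ∫⁻ y, f i y ∂μ i := by
  rw [lintegral_prod_eq_prod_lintegral_of_indepFun Finset.univ
    (fun i (x : ∀ i, X i) => f i (x i)) (iIndepFun_pi fun i => (hf i).aemeasurable)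
    (fun i => (hf i).comp (measurable_pi_apply i))]
  exact Finset.prod_congr rfl fun i _ => (measurePreserving_eval μ i).lintegral_comp (hf i)

/-- Boxes determine a product measure, and on a box the indicator factors along with the density. -/
theorem pi_withDensity {ι : Type*} [Fintype ι] {X : ι → Type*} [∀ i, MeasurableSpace (X i)]
    (μ : ∀ i, Measure (X i)) [∀ i, IsProbabilityMeasure (μ i)] (f : ∀ i, X i → ℝ≥0∞)
    (hf : ∀ i, Measurable (f i)) [∀ i, SigmaFinite ((μ i).withDensity (f i))] :
    Measure.pi (fun i => (μ i).withDensity (f i))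
      = (Measure.pi μ).withDensity fun x => ∏ i, f i (x i) := by
  refine Measure.pi_eq fun s hs => ?_
  have hbox : MeasurableSet (Set.univ.pi s) := MeasurableSet.univ_pi hs
  rw [withDensity_apply _ hbox, ← lintegral_indicator hbox]
  have h1 : ∀ x : ∀ i, X i, (Set.univ.pi s).indicator (fun x => ∏ i, f i (x i)) x
      = ∏ i, (s i).indicator (f i) (x i) := by
    intro x
    by_cases hx : x ∈ Set.univ.pi s
    · rw [Set.indicator_of_mem hx]
      exact Finset.prod_congr rfl fun i _ => (Set.indicator_of_mem (hx i trivial) _).symm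
    · rw [Set.indicator_of_notMem hx]
      simp only [Set.mem_pi, Set.mem_univ, true_implies, not_forall] at hx
      obtain ⟨i, hi⟩ := hx
      exact (Finset.prod_eq_zero (Finset.mem_univ i) (Set.indicator_of_notMem hi _)).symm
  have hm : ∀ i, Measurable ((s i).indicator (f i)) := fun i => (hf i).indicator (hs i)
  simp_rw [h1]
  rw [lintegral_pi_prod μ hm]
  exact Finset.prod_congr rfl fun i _ => by
    rw [withDensity_apply _ (hs i), ← lintegral_indicator (hs i)]

/-- A measure with density `exp ∘ H` on a set `A` has log-likelihood ratio `H`. -/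
theorem llr_of_eq_withDensity_exp {Θ : Type*} [MeasurableSpace Θ] {μ ρ : Measure Θ}
    [IsProbabilityMeasure μ] {A : Set Θ} (hA : MeasurableSet A) {H : Θ → ℝ} (hH : Measurable H)
    (hρ : ρ = (μ.restrict A).withDensity fun θ => ENNReal.ofReal (Real.exp (H θ))) :
    ρ ≪ μ ∧ llr ρ μ =ᵐ[ρ] H ∧ ∀ᵐ θ ∂ρ, θ ∈ A := by
  have hacr : ρ ≪ μ.restrict A := hρ ▸ withDensity_absolutelyContinuous _ _
  have hac : ρ ≪ μ := hacr.trans Measure.absolutelyContinuous_restrict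
  have hmem : ∀ᵐ θ ∂ρ, θ ∈ A := hacr.ae_le (ae_restrict_mem hA)
  refine ⟨hac, ?_, hmem⟩
  have hm : Measurable fun θ => ENNReal.ofReal (Real.exp (H θ)) := hH.exp.ennreal_ofReal
  have h1 : ρ = μ.withDensity (A.indicator fun θ => ENNReal.ofReal (Real.exp (H θ))) := by
    rw [hρ, withDensity_indicator hA]
  have h2 := Measure.rnDeriv_withDensity μ (hm.indicator hA)
  rw [← h1] at h2
  filter_upwards [hac.ae_le h2, hmem] with θ h3 h4
  rw [llr, h3, Set.indicator_of_mem h4, ENNReal.toReal_ofReal (Real.exp_pos _).le, Real.log_exp]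

end Density

/-! ### The reference law and its density with respect to the prior -/

section ReferenceLaw

/-- The logarithm of the density of `N(m, v)` with respect to `N(0, w)`. -/
noncomputable def logRatio (m v w u : ℝ) : ℝ :=
  1 / 2 * Real.log (w / v) - (u - m) ^ 2 / (2 * v) + u ^ 2 / (2 * w)

theorem gaussianReal_eq_withDensity_logRatio (m : ℝ) {v w : ℝ} (hv : 0 < v) (hw : 0 < w) :
    gaussianReal m v.toNNReal = (gaussianReal 0 w.toNNReal).withDensity
      fun u => ENNReal.ofReal (Real.exp (logRatio m v w u)) := by
  have hv' : v.toNNReal ≠ 0 := (Real.toNNReal_pos.2 hv).ne'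
  have hw' : w.toNNReal ≠ 0 := (Real.toNNReal_pos.2 hw).ne'
  have hmeas : Measurable fun u => ENNReal.ofReal (Real.exp (logRatio m v w u)) := by
    unfold logRatio; fun_prop
  rw [gaussianReal_of_var_ne_zero _ hv', gaussianReal_of_var_ne_zero _ hw',
    ← withDensity_mul _ (measurable_gaussianPDF _ _) hmeas]
  congr 1
  ext u
  rw [Pi.mul_apply, gaussianPDF, gaussianPDF,
    ← ENNReal.ofReal_mul (gaussianPDFReal_nonneg _ _ _)]
  congr 1
  have hs : Real.exp (1 / 2 * Real.log (w / v)) = √w / √v := by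
    rw [mul_comm, ← Real.rpow_def_of_pos (by positivity), ← Real.sqrt_eq_rpow,
      Real.sqrt_div' _ hv.le]
  simp only [gaussianPDFReal, logRatio, Real.coe_toNNReal _ hv.le, Real.coe_toNNReal _ hw.le]
  rw [sub_add_eq_add_sub, add_sub_assoc, Real.exp_add, hs, Real.sqrt_mul (by positivity) v,
    Real.sqrt_mul (by positivity) w]
  have h1 : Real.exp (-(u - m) ^ 2 / (2 * v))
      = Real.exp (-(u - 0) ^ 2 / (2 * w)) * Real.exp (u ^ 2 / (2 * w) - (u - m) ^ 2 / (2 * v)) := by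
    rw [← Real.exp_add]; congr 1; ring
  rw [h1]
  have := Real.sqrt_pos.2 hv
  have := Real.sqrt_pos.2 hw
  field_simp

variable {d m p K : ℕ}

/-- The law of a matrix with independent Gaussian entries: the mean of the entry `(i, k)` is
`c i k` and its variance `v k`. -/
noncomputable def rowLaw (c : Fin d → Fin K → ℝ) (v : Fin K → ℝ) (i : Fin d) :
    Measure (Fin K → ℝ) :=
  Measure.pi fun k => gaussianReal (c i k) (v k).toNNReal

instance (c : Fin d → Fin K → ℝ) (v : Fin K → ℝ) (i : Fin d) :
    IsProbabilityMeasure (rowLaw c v i) := by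
  unfold rowLaw; infer_instance

instance (d K : ℕ) : IsMarkovKernel (gaussianRows d K) :=
  ⟨fun γ => by
    change IsProbabilityMeasure (Measure.pi fun _ : Fin d => Measure.pi fun k : Fin K =>
      gaussianReal 0 (Real.toNNReal (γ k)))
    infer_instance⟩

/-- The log-density of a Gaussian matrix with respect to the prior given `γ`. -/
noncomputable def rowsLogRatio (c : Fin d → Fin K → ℝ) (v γ : Fin K → ℝ)
    (U : Fin d → Fin K → ℝ) : ℝ :=
  ∑ i, ∑ k, logRatio (c i k) (v k) (γ k) (U i k)

theorem measurable_rowsLogRatio {α : Type*} [MeasurableSpace α] (c : Fin d → Fin K → ℝ)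
    (v : Fin K → ℝ) {γ : α → Fin K → ℝ} {U : α → Fin d → Fin K → ℝ} (hγ : Measurable γ)
    (hU : Measurable U) : Measurable fun z => rowsLogRatio c v (γ z) (U z) := by
  unfold rowsLogRatio logRatio
  refine Finset.measurable_sum _ fun i _ => Finset.measurable_sum _ fun k _ => ?_
  have h1 : Measurable fun z => γ z k := (measurable_pi_apply k).comp hγ
  have h2 : Measurable fun z => U z i k :=
    (measurable_pi_apply k).comp ((measurable_pi_apply i).comp hU)
  fun_prop

theorem pi_rowLaw_eq_withDensity (c : Fin d → Fin K → ℝ) {v γ : Fin K → ℝ}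
    (hv : ∀ k, 0 < v k) (hγ : ∀ k, 0 < γ k) :
    Measure.pi (rowLaw c v) = (gaussianRows d K γ).withDensity
      fun U => ENNReal.ofReal (Real.exp (rowsLogRatio c v γ U)) := by
  have hm : ∀ i k, Measurable fun u =>
      ENNReal.ofReal (Real.exp (logRatio (c i k) (v k) (γ k) u)) := by
    intro i k; unfold logRatio; fun_prop
  have hrow : ∀ i, rowLaw c v i
      = (Measure.pi fun k => gaussianReal 0 (γ k).toNNReal).withDensity
        fun u => ∏ k, ENNReal.ofReal (Real.exp (logRatio (c i k) (v k) (γ k) (u k))) := by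
    intro i
    have h1 := fun k => gaussianReal_eq_withDensity_logRatio (c i k) (hv k) (hγ k)
    have : ∀ k, SigmaFinite ((gaussianReal 0 (γ k).toNNReal).withDensity
        fun u => ENNReal.ofReal (Real.exp (logRatio (c i k) (v k) (γ k) u))) := by
      intro k; rw [← h1 k]; infer_instance
    rw [rowLaw, ← pi_withDensity _ _ (hm i)]
    exact congrArg _ (funext h1)
  have : ∀ i, SigmaFinite ((Measure.pi fun k => gaussianReal 0 (γ k).toNNReal).withDensity
      fun u => ∏ k, ENNReal.ofReal (Real.exp (logRatio (c i k) (v k) (γ k) (u k)))) := by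
    intro i; rw [← hrow i]; infer_instance
  rw [funext hrow, pi_withDensity (fun _ : Fin d => Measure.pi fun k =>
    gaussianReal 0 (γ k).toNNReal) (fun i u =>
      ∏ k, ENNReal.ofReal (Real.exp (logRatio (c i k) (v k) (γ k) (u k))))
    fun i => Finset.measurable_prod _ fun k _ => (hm i k).comp (measurable_pi_apply k)]
  change _ = (Measure.pi fun _ : Fin d => Measure.pi fun k : Fin K =>
      gaussianReal 0 (γ k).toNNReal).withDensity _
  congr 1
  ext U
  rw [rowsLogRatio, Real.exp_sum, ENNReal.ofReal_prod_of_nonneg fun _ _ => (Real.exp_pos _).le]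
  refine Finset.prod_congr rfl fun i _ => ?_
  rw [Real.exp_sum, ENNReal.ofReal_prod_of_nonneg fun _ _ => (Real.exp_pos _).le]

/-- A mean-field law with Gaussian rows. -/
noncomputable def refLaw (τ : Fin K → Measure ℝ) (Ub : Fin m → Fin K → ℝ)
    (Vb : Fin p → Fin K → ℝ) (v : Fin K → ℝ) : Measure (Param m p K) :=
  (Measure.pi τ).prod ((Measure.pi (rowLaw Ub v)).prod (Measure.pi (rowLaw Vb v)))

/-- The log-density of `refLaw` with respect to the prior, when the `τ k` are normalized
restrictions of the prior. -/
noncomputable def refLogDensity (q : Fin K → ℝ) (Ub : Fin m → Fin K → ℝ)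
    (Vb : Fin p → Fin K → ℝ) (v : Fin K → ℝ) (θ : Param m p K) : ℝ :=
  ∑ k, -Real.log (q k) + rowsLogRatio Ub v θ.1 θ.2.1 + rowsLogRatio Vb v θ.1 θ.2.2

theorem measurable_refLogDensity (q : Fin K → ℝ) (Ub : Fin m → Fin K → ℝ)
    (Vb : Fin p → Fin K → ℝ) (v : Fin K → ℝ) : Measurable (refLogDensity q Ub Vb v) := by
  exact ((measurable_rowsLogRatio Ub v measurable_fst measurable_snd.fst).const_add _).add
    (measurable_rowsLogRatio Vb v measurable_fst measurable_snd.snd)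

theorem isProbabilityMeasure_invGammaMeasure {a b : ℝ} (ha : 0 < a) (hb : 0 < b) :
    IsProbabilityMeasure (invGammaMeasure a b) := by
  have := isProbabilityMeasure_gammaMeasure ha hb
  exact Measure.isProbabilityMeasure_map measurable_inv.aemeasurable

theorem isProbabilityMeasure_prior {a b : ℝ} (ha : 0 < a) (hb : 0 < b) :
    IsProbabilityMeasure (prior m p K a b) := by
  have := isProbabilityMeasure_invGammaMeasure ha hb
  unfold prior; infer_instance

/-- The parameters whose variances lie in given intervals. -/
def varianceBox (m p : ℕ) (lo hi : Fin K → ℝ) : Set (Param m p K) :=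
  {θ | θ.1 ∈ Set.univ.pi fun k => Set.Icc (lo k) (hi k)}

theorem measurableSet_varianceBox (lo hi : Fin K → ℝ) :
    MeasurableSet (varianceBox m p lo hi) :=
  measurable_fst (MeasurableSet.univ_pi fun _ => measurableSet_Icc)

/-- Under the prior `U` and `V` depend on `γ`, while under the reference law they do not;
disintegrating over `γ` reduces the comparison to Gaussians with a fixed prior variance. The lower
endpoints keep that variance positive, and conditioning each `γ k` on its interval contributes the
constant `-log (q k)`. -/
theorem refLaw_eq_withDensity {a b : ℝ} (ha : 0 < a) (hb : 0 < b) {lo hi v : Fin K → ℝ}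
    (hlo : ∀ k, 0 < lo k) (hv : ∀ k, 0 < v k)
    (hq : ∀ k, 0 < (invGammaMeasure a b).real (Set.Icc (lo k) (hi k)))
    (Ub : Fin m → Fin K → ℝ) (Vb : Fin p → Fin K → ℝ) :
    refLaw (fun k => (invGammaMeasure a b)[|Set.Icc (lo k) (hi k)]) Ub Vb v
      = ((prior m p K a b).restrict (varianceBox m p lo hi)).withDensity fun θ =>
        ENNReal.ofReal (Real.exp (refLogDensity
          (fun k => (invGammaMeasure a b).real (Set.Icc (lo k) (hi k))) Ub Vb v θ)) := by
  have hP := isProbabilityMeasure_invGammaMeasure ha hb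
  set q : Fin K → ℝ := fun k => (invGammaMeasure a b).real (Set.Icc (lo k) (hi k)) with hqdef
  set box : Set (Fin K → ℝ) := Set.univ.pi fun k => Set.Icc (lo k) (hi k) with hbox
  have hboxm : MeasurableSet box := MeasurableSet.univ_pi fun _ => measurableSet_Icc
  have hcond : ∀ k, IsProbabilityMeasure ((invGammaMeasure a b)[|Set.Icc (lo k) (hi k)]) := by
    intro k
    refine cond_isProbabilityMeasure fun h0 => ?_
    have := hq k
    simp [Measure.real, h0] at this
  have hpi : Measure.pi (fun k => (invGammaMeasure a b)[|Set.Icc (lo k) (hi k)])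
      = ENNReal.ofReal (Real.exp (∑ k, -Real.log (q k))) •
        (Measure.pi fun _ : Fin K => invGammaMeasure a b).restrict box := by
    refine Measure.pi_eq fun s hs => ?_
    rw [Measure.smul_apply, Measure.restrict_pi_pi, Measure.pi_pi, smul_eq_mul, Real.exp_sum,
      ENNReal.ofReal_prod_of_nonneg fun _ _ => (Real.exp_pos _).le, ← Finset.prod_mul_distrib]
    refine Finset.prod_congr rfl fun k _ => ?_
    rw [cond_apply measurableSet_Icc, Measure.restrict_apply (hs k), Set.inter_comm]
    congr 1
    rw [Real.exp_neg, Real.exp_log (hq k), ENNReal.ofReal_inv_of_pos (hq k)]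
    simp
  have hmeas := (measurable_refLogDensity q Ub Vb v).exp.ennreal_ofReal
  refine Measure.ext_of_lintegral _ fun f hf => ?_
  have hAm := measurableSet_varianceBox (m := m) (p := p) lo hi
  rw [lintegral_withDensity_eq_lintegral_mul _ hmeas hf, ← lintegral_indicator hAm, prior,
    Measure.lintegral_compProd ((hmeas.mul hf).indicator hAm), refLaw,
    lintegral_prod _ hf.aemeasurable, hpi, lintegral_smul_measure, ← lintegral_indicator hboxm,
    smul_eq_mul, ← lintegral_const_mul']
  swap
  · exact ENNReal.ofReal_ne_top
  refine lintegral_congr fun γ => ?_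
  -- Outside the box both integrands vanish; inside, the Gaussian density formula applies since
  -- every `γ k` is positive.
  by_cases hγ : γ ∈ box
  swap
  · have hz : ∀ z, (γ, z) ∉ varianceBox m p lo hi := fun z => hγ
    simp [Set.indicator_of_notMem hγ, Set.indicator_of_notMem (hz _)]
  have hγ0 : ∀ k, 0 < γ k := fun k => (hlo k).trans_le (hγ k trivial).1
  have hz : ∀ z, (γ, z) ∈ varianceBox m p lo hi := fun z => hγ
  simp only [Set.indicator_of_mem hγ, Set.indicator_of_mem (hz _)]
  have hmU : Measurable fun U => ENNReal.ofReal (Real.exp (rowsLogRatio Ub v γ U)) :=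
    (measurable_rowsLogRatio Ub v measurable_const measurable_id).exp.ennreal_ofReal
  have hmV : Measurable fun U => ENNReal.ofReal (Real.exp (rowsLogRatio Vb v γ U)) :=
    (measurable_rowsLogRatio Vb v measurable_const measurable_id).exp.ennreal_ofReal
  have hsU := pi_rowLaw_eq_withDensity Ub hv hγ0
  have hsV := pi_rowLaw_eq_withDensity Vb hv hγ0
  have i1 : SFinite ((gaussianRows m K γ).withDensity
    fun U => ENNReal.ofReal (Real.exp (rowsLogRatio Ub v γ U))) := hsU ▸ inferInstance
  have i2 : SFinite ((gaussianRows p K γ).withDensity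
    fun U => ENNReal.ofReal (Real.exp (rowsLogRatio Vb v γ U))) := hsV ▸ inferInstance
  have hmUV : Measurable fun z : (Fin m → Fin K → ℝ) × (Fin p → Fin K → ℝ) =>
      ENNReal.ofReal (Real.exp (rowsLogRatio Ub v γ z.1)) *
        ENNReal.ofReal (Real.exp (rowsLogRatio Vb v γ z.2)) :=
    (hmU.comp measurable_fst).mul (hmV.comp measurable_snd)
  have hfγ : Measurable fun z => f (γ, z) := hf.comp measurable_prodMk_left
  rw [hsU, hsV, prod_withDensity hmU hmV, Kernel.prod_apply,
    lintegral_withDensity_eq_lintegral_mul _ hmUV hfγ,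
    ← lintegral_const_mul' _ _ ENNReal.ofReal_ne_top]
  refine lintegral_congr fun z => ?_
  simp only [Pi.mul_apply, refLogDensity, Real.exp_add]
  rw [ENNReal.ofReal_mul (by positivity), ENNReal.ofReal_mul (by positivity)]
  ring

end ReferenceLaw

/-! ### Lower bounds for inverse gamma masses -/

section Gamma

/-- Writing `x ^ (a - 1)` as `x ^ a / x` and bounding each factor of the density by its worst
endpoint avoids a case distinction on the sign of `a - 1`. -/
theorem le_gammaMeasure_real_Icc {a b s t : ℝ} (ha : 0 < a) (hb : 0 < b) (hs : 0 < s)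
    (hst : s ≤ t) :
    (t - s) / t * (b * s) ^ a * Real.exp (-(b * t)) / Real.Gamma a
      ≤ (gammaMeasure a b).real (Set.Icc s t) := by
  have hP := isProbabilityMeasure_gammaMeasure ha hb
  have ht : 0 < t := hs.trans_le hst
  have hΓ := Real.Gamma_pos_of_pos ha
  rw [measureReal_def, ← ENNReal.ofReal_le_iff_le_toReal (measure_ne_top _ _), gammaMeasure,
    withDensity_apply _ measurableSet_Icc]
  set κ : ℝ := b ^ a / Real.Gamma a * (s ^ a / t) * Real.exp (-(b * t)) with hκ
  calc ENNReal.ofReal ((t - s) / t * (b * s) ^ a * Real.exp (-(b * t)) / Real.Gamma a)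
      = ∫⁻ _ in Set.Icc s t, ENNReal.ofReal κ := by
        rw [setLIntegral_const, Real.volume_Icc, ← ENNReal.ofReal_mul (by positivity), hκ,
          Real.mul_rpow hb.le hs.le]
        congr 1
        ring
    _ ≤ ∫⁻ x in Set.Icc s t, gammaPDF a b x := by
        refine setLIntegral_mono' measurableSet_Icc fun x hx => ?_
        have hx0 : 0 < x := hs.trans_le hx.1
        rw [gammaPDF_of_nonneg hx0.le]
        refine ENNReal.ofReal_le_ofReal ?_
        rw [hκ, Real.rpow_sub_one hx0.ne']
        have h1 : s ^ a / t ≤ x ^ a / x :=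
          div_le_div₀ (by positivity) (Real.rpow_le_rpow hs.le hx.1 ha.le) hx0 hx.2
        have h2 : Real.exp (-(b * t)) ≤ Real.exp (-(b * x)) :=
          Real.exp_le_exp.2 (neg_le_neg (mul_le_mul_of_nonneg_left hx.2 hb.le))
        gcongr

/-- The gamma bound transported by inversion, with `s = 1/hi` and `t = 1/lo`. -/
theorem le_invGammaMeasure_real_Icc {a b lo hi : ℝ} (ha : 0 < a) (hb : 0 < b) (hlo : 0 < lo)
    (hle : lo ≤ hi) :
    (hi - lo) / hi * (b / hi) ^ a * Real.exp (-(b / lo)) / Real.Gamma a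
      ≤ (invGammaMeasure a b).real (Set.Icc lo hi) := by
  have hhi : 0 < hi := hlo.trans_le hle
  have hP := isProbabilityMeasure_gammaMeasure ha hb
  have h := le_gammaMeasure_real_Icc ha hb (inv_pos.2 hhi) ((inv_le_inv₀ hhi hlo).2 hle)
  have h1 : (lo⁻¹ - hi⁻¹) / lo⁻¹ = (hi - lo) / hi := by field_simp
  rw [h1, ← div_eq_mul_inv, ← div_eq_mul_inv] at h
  refine h.trans ?_
  rw [invGammaMeasure, map_measureReal_apply measurable_inv measurableSet_Icc]
  refine measureReal_mono (fun x hx => ?_) (measure_ne_top _ _)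
  have hx0 : 0 < x := (inv_pos.2 hhi).trans_le hx.1
  exact ⟨(le_inv_comm₀ hlo hx0).2 hx.2, (inv_le_comm₀ hx0 hhi).2 hx.1⟩

theorem neg_log_invGammaMeasure_le {a b lo hi : ℝ} (ha : 0 < a) (hb : 0 < b) (hlo : 0 < lo)
    (hlt : lo < hi) :
    0 < (invGammaMeasure a b).real (Set.Icc lo hi) ∧
    -Real.log ((invGammaMeasure a b).real (Set.Icc lo hi))
      ≤ Real.log (hi / (hi - lo)) + a * Real.log (hi / b) + b / lo + Real.log (Real.Gamma a) := by
  have hhi : 0 < hi := hlo.trans hlt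
  have hd : 0 < hi - lo := sub_pos.2 hlt
  have hΓ := Real.Gamma_pos_of_pos ha
  have h := le_invGammaMeasure_real_Icc ha hb hlo hlt.le
  have hpos : 0 < (hi - lo) / hi * (b / hi) ^ a * Real.exp (-(b / lo)) / Real.Gamma a := by
    positivity
  refine ⟨hpos.trans_le h, ?_⟩
  have h2 := Real.log_le_log hpos h
  rw [Real.log_div (by positivity) hΓ.ne', Real.log_mul (by positivity) (by positivity),
    Real.log_mul (by positivity) (by positivity), Real.log_exp, Real.log_rpow (by positivity),
    Real.log_div hd.ne' hhi.ne', Real.log_div hb.ne' hhi.ne'] at h2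
  rw [Real.log_div hhi.ne' hd.ne', Real.log_div hhi.ne' hb.ne']
  linarith

/-- The mass that `Γ(a, 1)` gives to `[1, 2]` is at most one and at least `exp(-2) / (2 Γ(a))`. The
final comparison needs this because `log Γ(a)` may be negative. -/
theorem neg_two_add_log_two_le_log_Gamma {a : ℝ} (ha : 0 < a) :
    -(2 + Real.log 2) ≤ Real.log (Real.Gamma a) := by
  have hP := isProbabilityMeasure_gammaMeasure ha one_pos
  have hΓ := Real.Gamma_pos_of_pos ha
  have h := (le_gammaMeasure_real_Icc ha one_pos one_pos one_le_two).trans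
    (measureReal_le_one (μ := gammaMeasure a 1))
  rw [div_le_one hΓ] at h
  have h2 := Real.log_le_log (by positivity) h
  norm_num at h2
  rw [Real.log_mul (by norm_num) (Real.exp_pos _).ne', Real.log_exp, Real.log_div (by norm_num) (by norm_num),
    Real.log_one] at h2
  linarith

end Gamma

/-! ### Moments of the entries of `UVᵗ` under the reference law -/

section Moments

theorem integral_comp_measurePreserving {α β : Type*} [MeasurableSpace α] [MeasurableSpace β]
    {μ : Measure α} {ν : Measure β} {f : α → β} (hf : MeasurePreserving f μ ν) {g : β → ℝ}
    (hg : AEStronglyMeasurable g ν) : ∫ x, g (f x) ∂μ = ∫ y, g y ∂ν := by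
  rw [← hf.map_eq, integral_map hf.measurable.aemeasurable (by rwa [hf.map_eq])]

theorem integrable_comp_measurePreserving {α β : Type*} [MeasurableSpace α] [MeasurableSpace β]
    {μ : Measure α} {ν : Measure β} {f : α → β} (hf : MeasurePreserving f μ ν) {g : β → ℝ}
    (hg : Integrable g ν) : Integrable (fun x => g (f x)) μ :=
  Integrable.comp_measurable (by rwa [hf.map_eq]) hf.measurable

theorem integrable_sq_gaussianReal (c : ℝ) (v : ℝ≥0) :
    Integrable (fun u => u ^ 2) (gaussianReal c v) :=
  (memLp_id_gaussianReal 2).integrable_sq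

theorem integral_sq_gaussianReal (c : ℝ) (v : ℝ≥0) :
    ∫ u, u ^ 2 ∂gaussianReal c v = v + c ^ 2 := by
  have h := variance_eq_sub (memLp_id_gaussianReal (μ := c) (v := v) 2)
  rw [variance_id_gaussianReal] at h
  simp only [Pi.pow_apply, id_eq, integral_id_gaussianReal] at h
  linarith

theorem integrable_id_gaussianReal' (c : ℝ) (v : ℝ≥0) :
    Integrable (fun u => u) (gaussianReal c v) :=
  memLp_one_iff_integrable.1 (memLp_id_gaussianReal 1)

theorem integrable_quadratic_gaussianReal (c α₀ δ β : ℝ) (v : ℝ≥0) :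
    Integrable (fun u => α₀ - δ * (u - c) ^ 2 + β * u ^ 2) (gaussianReal c v) := by
  have h : Integrable (fun u => (u - c) ^ 2) (gaussianReal c v) :=
    ((memLp_id_gaussianReal 2).sub (memLp_const c)).integrable_sq
  exact ((integrable_const _).sub (h.const_mul _)).add
    ((integrable_sq_gaussianReal c v).const_mul _)

theorem integral_quadratic_gaussianReal (c α₀ δ β : ℝ) (v : ℝ≥0) :
    ∫ u, (α₀ - δ * (u - c) ^ 2 + β * u ^ 2) ∂gaussianReal c v
      = α₀ - δ * v + β * (v + c ^ 2) := by
  have h1 := integrable_sq_gaussianReal c v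
  have h2 := integrable_id_gaussianReal' c v
  have h3 : ∀ u : ℝ, α₀ - δ * (u - c) ^ 2 + β * u ^ 2
      = (α₀ - δ * c ^ 2) + (2 * δ * c) * u + (β - δ) * u ^ 2 := fun u => by ring
  simp_rw [h3]
  have h4 : Integrable (fun u => (α₀ - δ * c ^ 2) + (2 * δ * c) * u) (gaussianReal c v) :=
    (integrable_const _).add (h2.const_mul _)
  rw [integral_add h4 (h1.const_mul _), integral_add (integrable_const _) (h2.const_mul _), integral_const_mul, integral_const_mul,
    integral_sq_gaussianReal, integral_id_gaussianReal]
  simp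
  ring

variable {d m p K : ℕ}

theorem measurePreserving_eval_rowLaw (c : Fin d → Fin K → ℝ) (v : Fin K → ℝ) (i : Fin d)
    (k : Fin K) :
    MeasurePreserving (fun u : Fin K → ℝ => u k) (rowLaw c v i)
      (gaussianReal (c i k) (v k).toNNReal) :=
  measurePreserving_eval (fun k => gaussianReal (c i k) (v k).toNNReal) k

theorem memLp_eval_rowLaw (c : Fin d → Fin K → ℝ) (v : Fin K → ℝ) (i : Fin d) (k : Fin K) :
    MemLp (fun u : Fin K → ℝ => u k) 2 (rowLaw c v i) :=
  (memLp_id_gaussianReal 2).comp_measurePreserving (measurePreserving_eval_rowLaw c v i k)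

theorem integrable_mul_eval_rowLaw (c : Fin d → Fin K → ℝ) (v : Fin K → ℝ) (i : Fin d)
    (k l : Fin K) : Integrable (fun u : Fin K → ℝ => u k * u l) (rowLaw c v i) :=
  (memLp_eval_rowLaw c v i k).integrable_mul (memLp_eval_rowLaw c v i l)

theorem integral_eval_rowLaw (c : Fin d → Fin K → ℝ) (v : Fin K → ℝ) (i : Fin d)
    (k : Fin K) : ∫ u, u k ∂rowLaw c v i = c i k := by
  rw [integral_comp_measurePreserving (measurePreserving_eval_rowLaw c v i k)
    (g := fun u => u) (by fun_prop), integral_id_gaussianReal]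

theorem integral_mul_eval_rowLaw (c : Fin d → Fin K → ℝ) {v : Fin K → ℝ} (hv : ∀ k, 0 < v k)
    (i : Fin d) (k l : Fin K) :
    ∫ u, u k * u l ∂rowLaw c v i = c i k * c i l + if k = l then v k else 0 := by
  split_ifs with h
  · subst h
    simp_rw [← sq]
    rw [integral_comp_measurePreserving (measurePreserving_eval_rowLaw c v i k)
      (g := fun u => u ^ 2) (by fun_prop), integral_sq_gaussianReal, Real.coe_toNNReal _ (hv k).le, add_comm]
  · have hind := (iIndepFun_pi (μ := fun k => gaussianReal (c i k) (v k).toNNReal)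
      (X := fun _ u => u) fun _ => aemeasurable_id).indepFun h
    have h2 := hind.integral_fun_mul_eq_mul_integral
      (measurable_pi_apply k).aestronglyMeasurable (measurable_pi_apply l).aestronglyMeasurable
    rw [add_zero, ← integral_eval_rowLaw c v i k, ← integral_eval_rowLaw c v i l]
    exact h2

variable (τ : Fin K → Measure ℝ) [∀ k, IsProbabilityMeasure (τ k)] (Ub : Fin m → Fin K → ℝ)
  (Vb : Fin p → Fin K → ℝ) (v : Fin K → ℝ)

instance : IsProbabilityMeasure (refLaw τ Ub Vb v) := by
  unfold refLaw; infer_instance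

theorem refLaw_mem_meanField : refLaw τ Ub Vb v ∈ meanField m p K :=
  ⟨rowLaw Ub v, rowLaw Vb v, τ, inferInstance, inferInstance, inferInstance, rfl⟩

theorem measurePreserving_rows (i : Fin m) (j : Fin p) :
    MeasurePreserving (fun θ : Param m p K => (θ.2.1 i, θ.2.2 j)) (refLaw τ Ub Vb v)
      ((rowLaw Ub v i).prod (rowLaw Vb v j)) :=
  ((measurePreserving_eval (rowLaw Ub v) i).prod (measurePreserving_eval (rowLaw Vb v) j)).comp
    measurePreserving_snd

theorem measurePreserving_entry_left (i : Fin m) (k : Fin K) :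
    MeasurePreserving (fun θ : Param m p K => θ.2.1 i k) (refLaw τ Ub Vb v)
      (gaussianReal (Ub i k) (v k).toNNReal) :=
  (measurePreserving_eval (fun k => gaussianReal (Ub i k) (v k).toNNReal) k).comp
    ((measurePreserving_eval (rowLaw Ub v) i).comp
      (measurePreserving_fst.comp measurePreserving_snd))

theorem measurePreserving_entry_right (j : Fin p) (k : Fin K) :
    MeasurePreserving (fun θ : Param m p K => θ.2.2 j k) (refLaw τ Ub Vb v)
      (gaussianReal (Vb j k) (v k).toNNReal) :=
  (measurePreserving_eval (fun k => gaussianReal (Vb j k) (v k).toNNReal) k).comp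
    ((measurePreserving_eval (rowLaw Vb v) j).comp
      (measurePreserving_snd.comp measurePreserving_snd))

theorem toMatrix_apply (θ : Param m p K) (i : Fin m) (j : Fin p) :
    θ.toMatrix i j = ∑ k, θ.2.1 i k * θ.2.2 j k := by
  simp [Param.toMatrix, Matrix.mul_apply]

theorem measurable_toMatrix_apply (i : Fin m) (j : Fin p) :
    Measurable fun θ : Param m p K => θ.toMatrix i j := by
  simp_rw [toMatrix_apply]
  refine Finset.measurable_sum _ fun k _ => ?_
  have h1 : Measurable fun θ : Param m p K => θ.2.1 i k :=
    (measurable_pi_apply k).comp ((measurable_pi_apply i).comp measurable_snd.fst)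
  have h2 : Measurable fun θ : Param m p K => θ.2.2 j k :=
    (measurable_pi_apply k).comp ((measurable_pi_apply j).comp measurable_snd.snd)
  exact h1.mul h2

theorem integrable_toMatrix_apply (i : Fin m) (j : Fin p) :
    Integrable (fun θ : Param m p K => θ.toMatrix i j) (refLaw τ Ub Vb v) := by
  simp_rw [toMatrix_apply]
  refine integrable_finsetSum _ fun k _ => ?_
  exact integrable_comp_measurePreserving (measurePreserving_rows τ Ub Vb v i j)
    (((memLp_eval_rowLaw Ub v i k).integrable one_le_two).mul_prod
      ((memLp_eval_rowLaw Vb v j k).integrable one_le_two))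

theorem integral_toMatrix_apply (i : Fin m) (j : Fin p) :
    ∫ θ, θ.toMatrix i j ∂(refLaw τ Ub Vb v) = ∑ k, Ub i k * Vb j k := by
  simp_rw [toMatrix_apply]
  have h : ∀ k, Integrable (fun z : (Fin K → ℝ) × (Fin K → ℝ) => z.1 k * z.2 k)
      ((rowLaw Ub v i).prod (rowLaw Vb v j)) := fun k =>
    ((memLp_eval_rowLaw Ub v i k).integrable one_le_two).mul_prod
      ((memLp_eval_rowLaw Vb v j k).integrable one_le_two)
  rw [integral_comp_measurePreserving (measurePreserving_rows τ Ub Vb v i j)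
    (g := fun z => ∑ k, z.1 k * z.2 k) (integrable_finsetSum _ fun k _ => h k).1,
    integral_finsetSum _ fun k _ => h k]
  refine Finset.sum_congr rfl fun k _ => ?_
  rw [integral_prod_mul (fun u : Fin K → ℝ => u k) (fun u : Fin K → ℝ => u k),
    integral_eval_rowLaw, integral_eval_rowLaw]

theorem sq_toMatrix_apply (θ : Param m p K) (i : Fin m) (j : Fin p) :
    θ.toMatrix i j ^ 2
      = ∑ k, ∑ l, (θ.2.1 i k * θ.2.1 i l) * (θ.2.2 j k * θ.2.2 j l) := by
  rw [toMatrix_apply, sq, Finset.sum_mul_sum]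
  exact Finset.sum_congr rfl fun k _ => Finset.sum_congr rfl fun l _ => by ring

theorem integrable_mul_mul_rows (i : Fin m) (j : Fin p) (k l : Fin K) :
    Integrable (fun z : (Fin K → ℝ) × (Fin K → ℝ) => (z.1 k * z.1 l) * (z.2 k * z.2 l))
      ((rowLaw Ub v i).prod (rowLaw Vb v j)) :=
  (integrable_mul_eval_rowLaw Ub v i k l).mul_prod (integrable_mul_eval_rowLaw Vb v j k l)

theorem integrable_sq_toMatrix_apply (i : Fin m) (j : Fin p) :
    Integrable (fun θ : Param m p K => θ.toMatrix i j ^ 2) (refLaw τ Ub Vb v) := by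
  simp_rw [sq_toMatrix_apply]
  refine integrable_finsetSum _ fun k _ => integrable_finsetSum _ fun l _ => ?_
  exact integrable_comp_measurePreserving (measurePreserving_rows τ Ub Vb v i j)
    (integrable_mul_mul_rows Ub Vb v i j k l)

/-- A row of `U` is independent of a row of `V`, so each term of the expanded square factors into
two second moments. Only the diagonal terms `k = l` see the variances. -/
theorem integral_sq_toMatrix_apply (hv : ∀ k, 0 < v k) (i : Fin m) (j : Fin p) :
    ∫ θ, θ.toMatrix i j ^ 2 ∂(refLaw τ Ub Vb v) = (∑ k, Ub i k * Vb j k) ^ 2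
      + ∑ k, (v k * (Ub i k ^ 2 + Vb j k ^ 2) + v k ^ 2) := by
  simp_rw [sq_toMatrix_apply]
  have h := integrable_mul_mul_rows Ub Vb v i j
  rw [integral_comp_measurePreserving (measurePreserving_rows τ Ub Vb v i j)
    (g := fun z => ∑ k, ∑ l, (z.1 k * z.1 l) * (z.2 k * z.2 l))
    (integrable_finsetSum _ fun k _ => integrable_finsetSum _ fun l _ => h k l).1,
    integral_finsetSum _ fun k _ => integrable_finsetSum _ fun l _ => h k l]
  simp_rw [integral_finsetSum _ fun l _ => h _ l]
  have h2 : ∀ k l, ∫ z : (Fin K → ℝ) × (Fin K → ℝ), (z.1 k * z.1 l) * (z.2 k * z.2 l)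
        ∂((rowLaw Ub v i).prod (rowLaw Vb v j))
      = (Ub i k * Vb j k) * (Ub i l * Vb j l)
        + if k = l then v k * (Ub i k ^ 2 + Vb j k ^ 2) + v k ^ 2 else 0 := by
    intro k l
    rw [integral_prod_mul (fun u : Fin K → ℝ => u k * u l) (fun u : Fin K → ℝ => u k * u l),
      integral_mul_eval_rowLaw _ hv, integral_mul_eval_rowLaw _ hv]
    split_ifs with hkl
    · subst hkl; ring
    · ring
  simp_rw [h2, Finset.sum_add_distrib, sq (∑ k, Ub i k * Vb j k), Finset.sum_mul_sum]
  simp [Finset.sum_add_distrib]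

end Moments

/-! ### Divergence of the reference law from the prior -/

section LogDensity

variable {m p K : ℕ} (τ : Fin K → Measure ℝ) [∀ k, IsProbabilityMeasure (τ k)]
  (Ub : Fin m → Fin K → ℝ) (Vb : Fin p → Fin K → ℝ) (v : Fin K → ℝ)

theorem integrable_sum_left {φ : Fin m → Fin K → ℝ → ℝ}
    (h : ∀ i k, Integrable (φ i k) (gaussianReal (Ub i k) (v k).toNNReal)) :
    Integrable (fun θ : Param m p K => ∑ i, ∑ k, φ i k (θ.2.1 i k)) (refLaw τ Ub Vb v) :=
  integrable_finsetSum _ fun i _ => integrable_finsetSum _ fun k _ =>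
    integrable_comp_measurePreserving (measurePreserving_entry_left τ Ub Vb v i k) (h i k)

theorem integral_sum_left {φ : Fin m → Fin K → ℝ → ℝ}
    (h : ∀ i k, Integrable (φ i k) (gaussianReal (Ub i k) (v k).toNNReal)) :
    ∫ θ : Param m p K, ∑ i, ∑ k, φ i k (θ.2.1 i k) ∂(refLaw τ Ub Vb v)
      = ∑ i, ∑ k, ∫ u, φ i k u ∂gaussianReal (Ub i k) (v k).toNNReal := by
  have h1 := fun i k =>
    integrable_comp_measurePreserving (measurePreserving_entry_left τ Ub Vb v i k) (h i k)
  rw [integral_finsetSum _ fun i _ => integrable_finsetSum _ fun k _ => h1 i k]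
  refine Finset.sum_congr rfl fun i _ => ?_
  rw [integral_finsetSum _ fun k _ => h1 i k]
  exact Finset.sum_congr rfl fun k _ =>
    integral_comp_measurePreserving (measurePreserving_entry_left τ Ub Vb v i k) (h i k).1

theorem integrable_sum_right {φ : Fin p → Fin K → ℝ → ℝ}
    (h : ∀ j k, Integrable (φ j k) (gaussianReal (Vb j k) (v k).toNNReal)) :
    Integrable (fun θ : Param m p K => ∑ j, ∑ k, φ j k (θ.2.2 j k)) (refLaw τ Ub Vb v) :=
  integrable_finsetSum _ fun j _ => integrable_finsetSum _ fun k _ =>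
    integrable_comp_measurePreserving (measurePreserving_entry_right τ Ub Vb v j k) (h j k)

theorem integral_sum_right {φ : Fin p → Fin K → ℝ → ℝ}
    (h : ∀ j k, Integrable (φ j k) (gaussianReal (Vb j k) (v k).toNNReal)) :
    ∫ θ : Param m p K, ∑ j, ∑ k, φ j k (θ.2.2 j k) ∂(refLaw τ Ub Vb v)
      = ∑ j, ∑ k, ∫ u, φ j k u ∂gaussianReal (Vb j k) (v k).toNNReal := by
  have h1 := fun j k =>
    integrable_comp_measurePreserving (measurePreserving_entry_right τ Ub Vb v j k) (h j k)
  rw [integral_finsetSum _ fun j _ => integrable_finsetSum _ fun k _ => h1 j k]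
  refine Finset.sum_congr rfl fun j _ => ?_
  rw [integral_finsetSum _ fun k _ => h1 j k]
  exact Finset.sum_congr rfl fun k _ =>
    integral_comp_measurePreserving (measurePreserving_entry_right τ Ub Vb v j k) (h j k).1

/-- The quadratic function obtained from `logRatio` by freezing the two occurrences of the
variance of the prior. -/
noncomputable def quadBound (c v w β u : ℝ) : ℝ :=
  1 / 2 * Real.log (w / v) - 1 / (2 * v) * (u - c) ^ 2 + β * u ^ 2

theorem logRatio_le_quadBound {c v w lo hi u : ℝ} (hv : 0 < v) (hlo : 0 < lo) (h1 : lo ≤ w)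
    (h2 : w ≤ hi) : logRatio c v w u ≤ quadBound c v hi (1 / (2 * lo)) u := by
  have hw : 0 < w := hlo.trans_le h1
  have e1 : Real.log (w / v) ≤ Real.log (hi / v) :=
    Real.log_le_log (by positivity) (by gcongr)
  have e2 : u ^ 2 / (2 * w) ≤ 1 / (2 * lo) * u ^ 2 := by
    rw [one_div_mul_eq_div]; gcongr
  have e3 : (u - c) ^ 2 / (2 * v) = 1 / (2 * v) * (u - c) ^ 2 := (one_div_mul_eq_div _ _).symm
  unfold logRatio quadBound
  linarith

theorem quadBound_le_logRatio {c v w lo u : ℝ} (hv : 0 < v) (hlo : 0 < lo) (h1 : lo ≤ w) :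
    quadBound c v lo 0 u ≤ logRatio c v w u := by
  have hw : 0 < w := hlo.trans_le h1
  have e1 : Real.log (lo / v) ≤ Real.log (w / v) :=
    Real.log_le_log (by positivity) (by gcongr)
  have e2 : 0 ≤ u ^ 2 / (2 * w) := by positivity
  have e3 : (u - c) ^ 2 / (2 * v) = 1 / (2 * v) * (u - c) ^ 2 := (one_div_mul_eq_div _ _).symm
  unfold logRatio quadBound
  linarith

theorem integral_quadBound (c w β : ℝ) {v : ℝ} (hv : 0 < v) :
    ∫ u, quadBound c v w β u ∂gaussianReal c v.toNNReal
      = 1 / 2 * Real.log (w / v) - 1 / 2 + β * (v + c ^ 2) := by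
  unfold quadBound
  rw [integral_quadratic_gaussianReal, Real.coe_toNNReal _ hv.le]
  field_simp

/-- An upper bound for the contribution of one entry to the divergence from the prior. -/
noncomputable def entryCost (lo hi v c : ℝ) : ℝ :=
  1 / 2 * Real.log (hi / v) - 1 / 2 + 1 / (2 * lo) * (v + c ^ 2)

/-- On the variance box the log-density lies between two quadratic functions of `U` and `V` that no
longer involve `γ`. Their Gaussian integrals are explicit, so no integral over `γ` has to be
computed. -/
theorem integrable_refLogDensity_and_le (q : Fin K → ℝ) {lo hi : Fin K → ℝ}
    (hlo : ∀ k, 0 < lo k) (hv : ∀ k, 0 < v k)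
    (hmem : ∀ᵐ θ ∂(refLaw τ Ub Vb v), θ ∈ varianceBox m p lo hi) :
    Integrable (refLogDensity q Ub Vb v) (refLaw τ Ub Vb v) ∧
      ∫ θ, refLogDensity q Ub Vb v θ ∂(refLaw τ Ub Vb v)
        ≤ ∑ k, -Real.log (q k) + ∑ i, ∑ k, entryCost (lo k) (hi k) (v k) (Ub i k)
          + ∑ j, ∑ k, entryCost (lo k) (hi k) (v k) (Vb j k) := by
  have hU : ∀ w β : Fin K → ℝ, ∀ i k, Integrable (quadBound (Ub i k) (v k) (w k) (β k))
      (gaussianReal (Ub i k) (v k).toNNReal) :=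
    fun w β i k => integrable_quadratic_gaussianReal _ _ _ _ _
  have hV : ∀ w β : Fin K → ℝ, ∀ i k, Integrable (quadBound (Vb i k) (v k) (w k) (β k))
      (gaussianReal (Vb i k) (v k).toNNReal) :=
    fun w β i k => integrable_quadratic_gaussianReal _ _ _ _ _
  let F : (Fin K → ℝ) → (Fin K → ℝ) → Param m p K → ℝ := fun w β θ =>
    ∑ k, -Real.log (q k) + ∑ i, ∑ k, quadBound (Ub i k) (v k) (w k) (β k) (θ.2.1 i k)
      + ∑ j, ∑ k, quadBound (Vb j k) (v k) (w k) (β k) (θ.2.2 j k)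
  have hI : ∀ w β, Integrable (F w β) (refLaw τ Ub Vb v) := fun w β =>
    ((integrable_const _).add (integrable_sum_left τ Ub Vb v (hU w β))).add
      (integrable_sum_right τ Ub Vb v (hV w β))
  have hup : refLogDensity q Ub Vb v ≤ᵐ[refLaw τ Ub Vb v] F hi (fun k => 1 / (2 * lo k)) := by
    filter_upwards [hmem] with θ hθ
    refine add_le_add (add_le_add le_rfl ?_) ?_ <;>
    exact Finset.sum_le_sum fun i _ => Finset.sum_le_sum fun k _ =>
      logRatio_le_quadBound (hv k) (hlo k) (hθ k trivial).1 (hθ k trivial).2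
  have hdown : F lo (fun _ => 0) ≤ᵐ[refLaw τ Ub Vb v] refLogDensity q Ub Vb v := by
    filter_upwards [hmem] with θ hθ
    refine add_le_add (add_le_add le_rfl ?_) ?_ <;>
    exact Finset.sum_le_sum fun i _ => Finset.sum_le_sum fun k _ =>
      quadBound_le_logRatio (hv k) (hlo k) (hθ k trivial).1
  have hint : Integrable (refLogDensity q Ub Vb v) (refLaw τ Ub Vb v) :=
    integrable_of_le_of_le (measurable_refLogDensity q Ub Vb v).aestronglyMeasurable hdown hup
      (hI _ _) (hI _ _)
  refine ⟨hint, (integral_mono_ae hint (hI _ _) hup).trans_eq ?_⟩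
  have i1 := integrable_sum_left τ Ub Vb v (hU hi fun k => 1 / (2 * lo k))
  have i2 := integrable_sum_right τ Ub Vb v (hV hi fun k => 1 / (2 * lo k))
  have i3 := (integrable_const (μ := refLaw τ Ub Vb v) (∑ k, -Real.log (q k))).add i1
  change ∫ θ, (∑ k, -Real.log (q k) + _ + _) ∂_ = _
  refine (integral_add i3 i2).trans ?_
  rw [integral_sum_right τ Ub Vb v (hV hi fun k => 1 / (2 * lo k))]
  refine congrArg₂ _ ?_ ?_
  · refine (integral_add (integrable_const _) i1).trans ?_
    rw [integral_sum_left τ Ub Vb v (hU hi fun k => 1 / (2 * lo k)), integral_const]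
    simp only [integral_quadBound _ _ _ (hv _), entryCost, probReal_univ, one_smul]
  · simp only [integral_quadBound _ _ _ (hv _), entryCost]

end LogDensity

/-! ### The observation model and its likelihood -/

section Model

variable {m p n K : ℕ} {σ : ℝ}

theorem measurable_obs_map (M : Matrix (Fin m) (Fin p) ℝ) :
    Measurable fun z : (Fin m × Fin p) × ℝ => (z.1, M z.1.1 z.1.2 + z.2) := by
  refine measurable_from_prod_countable_right fun z => measurable_const.prodMk ?_
  exact (measurable_const_add (M z.1 z.2) : Measurable fun y : ℝ => M z.1 z.2 + y)

/-- This finite mixture form reduces integrals over an observation to one-dimensional Gaussian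
integrals, one per position. -/
theorem obsLaw_eq_sum (σ : ℝ) (M : Matrix (Fin m) (Fin p) ℝ) :
    obsLaw σ M = ∑ z : Fin m × Fin p, ((m * p : ℕ) : ℝ≥0∞)⁻¹ •
      (gaussianReal (M z.1 z.2) (σ ^ 2).toNNReal).map (Prod.mk z) := by
  have hu : uniformOn (Set.univ : Set (Fin m × Fin p))
      = ((m * p : ℕ) : ℝ≥0∞)⁻¹ • Measure.count := by
    rw [uniformOn, ProbabilityTheory.cond, Measure.restrict_univ, Measure.count_univ]
    simp
  have hmeas := measurable_obs_map M
  refine Measure.ext_of_lintegral _ fun f hf => ?_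
  have hfm : Measurable fun z : (Fin m × Fin p) × ℝ => f (z.1, M z.1.1 z.1.2 + z.2) :=
    hf.comp hmeas
  rw [obsLaw, lintegral_map hf hmeas, lintegral_prod _ hfm.aemeasurable, hu,
    lintegral_smul_measure, lintegral_count, tsum_fintype, lintegral_finsetSum_measure,
    smul_eq_mul, Finset.mul_sum]
  refine Finset.sum_congr rfl fun z _ => ?_
  have hg : gaussianReal (M z.1 z.2) (σ ^ 2).toNNReal
      = (gaussianReal 0 (σ ^ 2).toNNReal).map (M z.1 z.2 + ·) := by
    rw [gaussianReal_map_const_add, zero_add]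
  rw [lintegral_smul_measure, smul_eq_mul, lintegral_map hf measurable_prodMk_left, hg,
    lintegral_map (f := fun y => f (z, y)) (hf.comp measurable_prodMk_left) (by fun_prop)]

theorem isProbabilityMeasure_obsLaw (hm : 1 ≤ m) (hp : 1 ≤ p) (σ : ℝ)
    (M : Matrix (Fin m) (Fin p) ℝ) : IsProbabilityMeasure (obsLaw σ M) := by
  have : NeZero m := ⟨by omega⟩
  have : NeZero p := ⟨by omega⟩
  have := isProbabilityMeasure_uniformOn (Set.finite_univ (α := Fin m × Fin p))
    Set.univ_nonempty
  exact Measure.isProbabilityMeasure_map (measurable_obs_map M).aemeasurable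

theorem integral_obsLaw_fst (hm : 1 ≤ m) (hp : 1 ≤ p) (σ : ℝ) (M : Matrix (Fin m) (Fin p) ℝ)
    (h : Fin m × Fin p → ℝ) :
    ∫ o, h o.1 ∂(obsLaw σ M) = ((m : ℝ) * p)⁻¹ * ∑ z, h z := by
  have hmeas : Measurable fun o : Obs m p => h o.1 :=
    (measurable_of_countable h).comp measurable_fst
  have hmap : ∀ z : Fin m × Fin p, ∫ o, h o.1
      ∂((gaussianReal (M z.1 z.2) (σ ^ 2).toNNReal).map (Prod.mk z)) = h z := by
    intro z
    rw [integral_map (by fun_prop) hmeas.aestronglyMeasurable]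
    simp
  have hint : ∀ z : Fin m × Fin p, Integrable (fun o : Obs m p => h o.1)
      ((gaussianReal (M z.1 z.2) (σ ^ 2).toNNReal).map (Prod.mk z)) := by
    intro z
    have : IsProbabilityMeasure
        ((gaussianReal (M z.1 z.2) (σ ^ 2).toNNReal).map (Prod.mk z)) :=
      Measure.isProbabilityMeasure_map (by fun_prop)
    refine Integrable.of_bound hmeas.aestronglyMeasurable (∑ w, ‖h w‖)
      (Filter.Eventually.of_forall fun o => ?_)
    exact Finset.single_le_sum (f := fun w => ‖h w‖) (fun _ _ => norm_nonneg _) (Finset.mem_univ _)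
  have hmp : ((m * p : ℕ) : ℝ≥0∞)⁻¹ ≠ ∞ :=
    ENNReal.inv_ne_top.2 (Nat.cast_ne_zero.2 (by positivity))
  rw [obsLaw_eq_sum, integral_finsetSum_measure fun z _ => (hint z).smul_measure hmp,
    Finset.mul_sum]
  refine Finset.sum_congr rfl fun z _ => ?_
  rw [integral_smul_measure, hmap]
  simp

/-- The log-likelihood of one observation. -/
noncomputable def obsLog (σ : ℝ) (M : Matrix (Fin m) (Fin p) ℝ) (o : Obs m p) : ℝ :=
  -Real.log √(2 * Real.pi * σ ^ 2) - (o.2 - M o.1.1 o.1.2) ^ 2 / (2 * σ ^ 2)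

theorem logLikelihood_eq (hσ : 0 < σ) (x : Fin n → Obs m p) (M : Matrix (Fin m) (Fin p) ℝ) :
    logLikelihood σ x M = ∑ k, obsLog σ M (x k) := by
  refine Finset.sum_congr rfl fun k _ => ?_
  rw [gaussianPDFReal, Real.coe_toNNReal _ (sq_nonneg σ),
    Real.log_mul (by positivity) (Real.exp_pos _).ne', Real.log_exp, Real.log_inv, obsLog]
  ring

theorem measurable_entry {α : Type*} [MeasurableSpace α] {z : α → Fin m × Fin p}
    {M : α → Matrix (Fin m) (Fin p) ℝ} (hz : Measurable z)
    (hM : ∀ i j, Measurable fun a => M a i j) : Measurable fun a => M a (z a).1 (z a).2 := by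
  have h : Measurable fun w : (Fin m × Fin p) × α => M w.2 w.1.1 w.1.2 :=
    measurable_from_prod_countable_right fun z => hM z.1 z.2
  exact h.comp (hz.prodMk measurable_id)

theorem measurable_obsLog {α : Type*} [MeasurableSpace α] {o : α → Obs m p}
    {M : α → Matrix (Fin m) (Fin p) ℝ} (ho : Measurable o)
    (hM : ∀ i j, Measurable fun a => M a i j) : Measurable fun a => obsLog σ (M a) (o a) := by
  exact measurable_const.sub
    (((ho.snd.sub (measurable_entry ho.fst hM)).pow_const 2).div_const _)

theorem measurable_logLikelihood (hσ : 0 < σ) {α : Type*} [MeasurableSpace α]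
    {x : α → Fin n → Obs m p} {M : α → Matrix (Fin m) (Fin p) ℝ} (hx : Measurable x)
    (hM : ∀ i j, Measurable fun a => M a i j) :
    Measurable fun a => logLikelihood σ (x a) (M a) := by
  simp_rw [logLikelihood_eq hσ]
  exact Finset.measurable_sum _ fun k _ =>
    measurable_obsLog ((measurable_pi_apply k).comp hx) hM

theorem logLikelihood_le (hσ : 0 < σ) (x : Fin n → Obs m p) (M : Matrix (Fin m) (Fin p) ℝ) :
    logLikelihood σ x M ≤ n * -Real.log √(2 * Real.pi * σ ^ 2) := by
  rw [logLikelihood_eq hσ]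
  refine (Finset.sum_le_card_nsmul _ _ (-Real.log √(2 * Real.pi * σ ^ 2)) fun k _ => ?_).trans_eq
    (by simp)
  have : 0 ≤ ((x k).2 - M (x k).1.1 (x k).1.2) ^ 2 / (2 * σ ^ 2) := by positivity
  unfold obsLog
  linarith

theorem integrable_exp_logLikelihood (hσ : 0 < σ) {α : ℝ} (hα : 0 < α) (x : Fin n → Obs m p)
    (μ : Measure (Param m p K)) [IsProbabilityMeasure μ] :
    Integrable (fun θ => Real.exp (α * logLikelihood σ x θ.toMatrix)) μ := by
  have hm : Measurable fun θ : Param m p K => logLikelihood σ x θ.toMatrix :=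
    measurable_logLikelihood hσ measurable_const measurable_toMatrix_apply
  refine integrable_of_abs_le
    (c := Real.exp (α * (n * -Real.log √(2 * Real.pi * σ ^ 2)))) (by fun_prop) fun θ => ?_
  rw [abs_of_pos (Real.exp_pos _)]
  exact Real.exp_le_exp.2 (mul_le_mul_of_nonneg_left (logLikelihood_le hσ x _) hα.le)

/-- At a fixed position the log-likelihood difference is affine in `y`, so the Gaussian moment
generating function applies; completing the square leaves the factor `α(1-α)`. -/
theorem lintegral_exp_obsLog_sub (hσ : 0 < σ) (α : ℝ) (M M₀ : Matrix (Fin m) (Fin p) ℝ) :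
    ∫⁻ o, ENNReal.ofReal (Real.exp (α * (obsLog σ M o - obsLog σ M₀ o))) ∂(obsLaw σ M₀)
      = ENNReal.ofReal (((m : ℝ) * p)⁻¹ *
        ∑ z : Fin m × Fin p, Real.exp (-(α * (1 - α) / (2 * σ ^ 2) *
          (M z.1 z.2 - M₀ z.1 z.2) ^ 2))) := by
  have hmeas : ∀ M : Matrix (Fin m) (Fin p) ℝ, Measurable (obsLog σ M) := fun M =>
    measurable_obsLog measurable_id fun _ _ => measurable_const
  have hF : Measurable fun o : Obs m p =>
      ENNReal.ofReal (Real.exp (α * (obsLog σ M o - obsLog σ M₀ o))) :=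
    (((hmeas M).sub (hmeas M₀)).const_mul α).exp.ennreal_ofReal
  have h1 : ∀ z : Fin m × Fin p, ∫⁻ o, ENNReal.ofReal
      (Real.exp (α * (obsLog σ M o - obsLog σ M₀ o)))
        ∂((gaussianReal (M₀ z.1 z.2) (σ ^ 2).toNNReal).map (Prod.mk z))
      = ENNReal.ofReal (Real.exp (-(α * (1 - α) / (2 * σ ^ 2) *
          (M z.1 z.2 - M₀ z.1 z.2) ^ 2))) := by
    intro z
    rw [lintegral_map hF measurable_prodMk_left]
    set c₀ := M₀ z.1 z.2 with hc₀
    set c := M z.1 z.2 with hc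
    have h2 : ∀ y : ℝ, Real.exp (α * (obsLog σ M (z, y) - obsLog σ M₀ (z, y)))
        = Real.exp (α * (c₀ ^ 2 - c ^ 2) / (2 * σ ^ 2)) *
          Real.exp (α * (c - c₀) / σ ^ 2 * y) := by
      intro y
      rw [← Real.exp_add]
      congr 1
      simp only [obsLog, ← hc₀, ← hc]
      field_simp
      ring
    simp_rw [h2]
    rw [← ofReal_integral_eq_lintegral_ofReal
      ((integrable_exp_mul_gaussianReal _).const_mul _)
      (Filter.Eventually.of_forall fun y => by positivity), integral_const_mul]
    have h3 := congrFun (mgf_fun_id_gaussianReal (μ := c₀) (v := (σ ^ 2).toNNReal))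
      (α * (c - c₀) / σ ^ 2)
    rw [mgf, Real.coe_toNNReal _ (sq_nonneg σ)] at h3
    rw [h3, ← Real.exp_add]
    congr 2
    field_simp
    ring
  rw [obsLaw_eq_sum, lintegral_finsetSum_measure, ENNReal.ofReal_mul (by positivity),
    ENNReal.ofReal_sum_of_nonneg fun _ _ => (Real.exp_pos _).le, Finset.mul_sum]
  refine Finset.sum_congr rfl fun z _ => ?_
  rw [lintegral_smul_measure, h1, smul_eq_mul]
  -- The position `z` itself witnesses that `m` and `p` are positive.
  rcases Nat.eq_zero_or_pos (m * p) with h0 | h0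
  · exact absurd z.1.pos (by rcases Nat.mul_eq_zero.1 h0 with h | h
                             · omega
                             · exact absurd z.2.pos (by omega))
  · congr 1
    rw [ENNReal.ofReal_inv_of_pos (by exact_mod_cast h0), ← Nat.cast_mul,
      ENNReal.ofReal_natCast]

end Model

/-! ### From the likelihood affinity to the clipped squared loss -/

section Clip

variable {m p : ℕ}

/-- The curvature constant relating the squared distance of clipped matrices to the Rényi
divergence. -/
noncomputable def curv (C c : ℝ) : ℝ := (1 - Real.exp (-(c * (4 * C ^ 2)))) / (4 * C ^ 2)

/-- `1 - exp(-c t)` is concave in `t` and vanishes at `0`, so on `[0, 4C²]` it lies above its chord,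
whose slope is `curv C c`. -/
theorem curv_mul_le {C c t : ℝ} (hC : 0 < C) (ht : 0 ≤ t) (htC : t ≤ 4 * C ^ 2) :
    curv C c * t ≤ 1 - Real.exp (-(c * t)) := by
  have h4 : (0 : ℝ) < 4 * C ^ 2 := by positivity
  have hl : t / (4 * C ^ 2) ≤ 1 := (div_le_one h4).2 htC
  have h := convexOn_exp.2 (Set.mem_univ (0 : ℝ)) (Set.mem_univ (-(c * (4 * C ^ 2))))
    (sub_nonneg.2 hl) (div_nonneg ht h4.le) (by ring)
  have he : (1 - t / (4 * C ^ 2)) • (0 : ℝ) + (t / (4 * C ^ 2)) • (-(c * (4 * C ^ 2)))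
      = -(c * t) := by
    simp only [smul_eq_mul]; field_simp; ring
  rw [he, Real.exp_zero] at h
  simp only [smul_eq_mul] at h
  have e2 : curv C c * t = t / (4 * C ^ 2) * (1 - Real.exp (-(c * (4 * C ^ 2)))) := by
    unfold curv; ring
  rw [e2]
  linarith

/-- Clipping projects onto an interval that contains `y`, which brings `x` no farther from `y` and
leaves both points in an interval of length `2C`. -/
theorem abs_clip_sub_le {C x y : ℝ} (hy : |y| ≤ C) :
    |min (max x (-C)) C - y| ≤ |x - y| ∧ |min (max x (-C)) C - y| ≤ 2 * C := by
  obtain ⟨h1, h2⟩ := abs_le.1 hy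
  rcases le_total x (-C) with h | h
  · rw [max_eq_right h, min_eq_left (by linarith)]
    constructor <;> rw [abs_le]
    · rw [abs_of_nonpos (by linarith : x - y ≤ 0)]; constructor <;> linarith
    · constructor <;> linarith
  · rw [max_eq_left h]
    rcases le_total x C with h' | h'
    · rw [min_eq_left h']
      exact ⟨le_rfl, abs_le.2 ⟨by linarith, by linarith⟩⟩
    · rw [min_eq_right h']
      constructor <;> rw [abs_le]
      · rw [abs_of_nonneg (by linarith : 0 ≤ x - y)]; constructor <;> linarith
      · constructor <;> linarith

theorem curv_mul_sq_clip_le {C c x y : ℝ} (hC : 0 < C) (hc : 0 ≤ c) (hy : |y| ≤ C) :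
    curv C c * (min (max x (-C)) C - y) ^ 2 ≤ 1 - Real.exp (-(c * (x - y) ^ 2)) := by
  obtain ⟨h1, h2⟩ := abs_clip_sub_le (x := x) hy
  have h1' := sq_le_sq.2 h1
  have h2' : (min (max x (-C)) C - y) ^ 2 ≤ 4 * C ^ 2 := by
    have := sq_le_sq' (abs_le.1 h2).1 (abs_le.1 h2).2
    linarith
  refine (curv_mul_le hC (sq_nonneg _) h2').trans ?_
  gcongr

theorem frobeniusSq_eq (M : Matrix (Fin m) (Fin p) ℝ) :
    frobeniusSq M = ∑ z : Fin m × Fin p, M z.1 z.2 ^ 2 :=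
  (Fintype.sum_prod_type' fun i j => M i j ^ 2).symm

/-- The chord bound at every entry gives `1 - u`, with `u` the scaled clipped loss, and `1 - u ≤
exp(-u)` puts it in a form that tensorizes over the sample. -/
theorem mean_exp_le (hm : 1 ≤ m) (hp : 1 ≤ p) {C c : ℝ} (hC : 0 < C) (hc : 0 ≤ c)
    (M M₀ : Matrix (Fin m) (Fin p) ℝ) (hM₀ : ∀ i j, |M₀ i j| ≤ C) :
    ((m : ℝ) * p)⁻¹ * ∑ z : Fin m × Fin p, Real.exp (-(c * (M z.1 z.2 - M₀ z.1 z.2) ^ 2))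
      ≤ Real.exp (-(curv C c * (frobeniusSq (clip C M - M₀) / ((m : ℝ) * p)))) := by
  have hmp : (0 : ℝ) < (m : ℝ) * p := by positivity
  refine le_trans ?_ (Real.add_one_le_exp _)
  have h : ∑ z : Fin m × Fin p, Real.exp (-(c * (M z.1 z.2 - M₀ z.1 z.2) ^ 2))
      ≤ ∑ z : Fin m × Fin p, (1 - curv C c * (clip C M - M₀) z.1 z.2 ^ 2) := by
    refine Finset.sum_le_sum fun z _ => ?_
    have := curv_mul_sq_clip_le (x := M z.1 z.2) hC hc (hM₀ z.1 z.2)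
    simp only [Matrix.sub_apply, clip, Matrix.of_apply]
    linarith
  rw [Finset.sum_sub_distrib, ← Finset.mul_sum, ← frobeniusSq_eq] at h
  simp only [Finset.sum_const, Finset.card_univ, Fintype.card_prod, Fintype.card_fin,
    nsmul_eq_mul, mul_one, Nat.cast_mul] at h
  calc _ ≤ ((m : ℝ) * p)⁻¹ * ((m : ℝ) * p - curv C c * frobeniusSq (clip C M - M₀)) := by gcongr
    _ = _ := by field_simp; ring

theorem frobeniusSq_clip_le {C : ℝ} (M M₀ : Matrix (Fin m) (Fin p) ℝ)
    (hM₀ : ∀ i j, |M₀ i j| ≤ C) :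
    frobeniusSq (clip C M - M₀) ≤ m * p * (4 * C ^ 2) := by
  rw [frobeniusSq_eq]
  refine (Finset.sum_le_card_nsmul _ _ (4 * C ^ 2) fun z _ => ?_).trans_eq (by simp)
  have h2 := (abs_clip_sub_le (x := M z.1 z.2) (hM₀ z.1 z.2)).2
  have := sq_le_sq' (abs_le.1 h2).1 (abs_le.1 h2).2
  simp only [Matrix.sub_apply, clip, Matrix.of_apply]
  linarith

theorem frobeniusSq_nonneg (M : Matrix (Fin m) (Fin p) ℝ) : 0 ≤ frobeniusSq M :=
  Finset.sum_nonneg fun _ _ => Finset.sum_nonneg fun _ _ => sq_nonneg _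

theorem measurable_frobeniusSq_clip {K : ℕ} (C : ℝ) (M₀ : Matrix (Fin m) (Fin p) ℝ) :
    Measurable fun θ : Param m p K => frobeniusSq (clip C θ.toMatrix - M₀) := by
  unfold frobeniusSq
  refine Finset.measurable_sum _ fun i _ => Finset.measurable_sum _ fun j _ => ?_
  simp only [Matrix.sub_apply, clip, Matrix.of_apply]
  have := measurable_toMatrix_apply (m := m) (p := p) (K := K) i j
  fun_prop

end Clip

/-! ### The PAC-Bayesian risk bound -/

section Risk

variable {m p n K : ℕ} {σ : ℝ}

theorem lintegral_exp_logLikelihood_sub (hm : 1 ≤ m) (hp : 1 ≤ p) (hσ : 0 < σ) (α : ℝ)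
    (M M₀ : Matrix (Fin m) (Fin p) ℝ) :
    ∫⁻ x : Fin n → Obs m p, ENNReal.ofReal
        (Real.exp (α * (logLikelihood σ x M - logLikelihood σ x M₀))) ∂(sampleLaw n σ M₀)
      = ENNReal.ofReal (((m : ℝ) * p)⁻¹ *
        ∑ z : Fin m × Fin p, Real.exp (-(α * (1 - α) / (2 * σ ^ 2) *
          (M z.1 z.2 - M₀ z.1 z.2) ^ 2))) ^ n := by
  have := isProbabilityMeasure_obsLaw hm hp σ M₀
  have hmeas : ∀ M : Matrix (Fin m) (Fin p) ℝ, Measurable (obsLog σ M) := fun M =>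
    measurable_obsLog measurable_id fun _ _ => measurable_const
  have hF : Measurable fun o : Obs m p =>
      ENNReal.ofReal (Real.exp (α * (obsLog σ M o - obsLog σ M₀ o))) :=
    (((hmeas M).sub (hmeas M₀)).const_mul α).exp.ennreal_ofReal
  have h := lintegral_pi_prod (fun _ : Fin n => obsLaw σ M₀) fun _ => hF
  rw [sampleLaw]
  simp only [lintegral_exp_obsLog_sub hσ, Finset.prod_const, Finset.card_univ,
    Fintype.card_fin] at h
  rw [← h]
  refine lintegral_congr fun x => ?_
  rw [logLikelihood_eq hσ, logLikelihood_eq hσ, ← Finset.sum_sub_distrib, Finset.mul_sum,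
    Real.exp_sum, ENNReal.ofReal_prod_of_nonneg fun _ _ => (Real.exp_pos _).le]

/-- The loss, scaled so that its exponential moment under the fractional posterior is
controlled. -/
noncomputable def scaledLoss (n : ℕ) (C c : ℝ) (M₀ : Matrix (Fin m) (Fin p) ℝ)
    (θ : Param m p K) : ℝ :=
  n * curv C c * (frobeniusSq (clip C θ.toMatrix - M₀) / ((m : ℝ) * p))

theorem measurable_scaledLoss (n : ℕ) (C c : ℝ) (M₀ : Matrix (Fin m) (Fin p) ℝ) :
    Measurable (scaledLoss (K := K) n C c M₀) :=
  ((measurable_frobeniusSq_clip C M₀).div_const _).const_mul _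

theorem curv_pos {C c : ℝ} (hC : 0 < C) (hc : 0 < c) : 0 < curv C c := by
  have h : Real.exp (-(c * (4 * C ^ 2))) < 1 := Real.exp_lt_one_iff.2 (by
    have : 0 < c * (4 * C ^ 2) := by positivity
    linarith)
  exact div_pos (sub_pos.2 h) (by positivity)

theorem abs_scaledLoss_le (hm : 1 ≤ m) (hp : 1 ≤ p) (n : ℕ) {C c : ℝ} (hC : 0 < C) (hc : 0 < c)
    {M₀ : Matrix (Fin m) (Fin p) ℝ} (hM₀ : ∀ i j, |M₀ i j| ≤ C) (θ : Param m p K) :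
    |scaledLoss n C c M₀ θ| ≤ n * curv C c * (4 * C ^ 2) := by
  have hmp : (0 : ℝ) < (m : ℝ) * p := by positivity
  have h0 := frobeniusSq_nonneg (clip C θ.toMatrix - M₀)
  have hk := (curv_pos hC hc).le
  have h1 : frobeniusSq (clip C θ.toMatrix - M₀) / ((m : ℝ) * p) ≤ 4 * C ^ 2 := by
    rw [div_le_iff₀ hmp, mul_comm]
    exact frobeniusSq_clip_le _ _ hM₀
  rw [scaledLoss, abs_of_nonneg (by positivity)]
  gcongr

/-- After exchanging the integrals, `θ` is fixed: the `n`-th power of the affinity is at most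
`exp(-scaledLoss)`, and the scaling is chosen so that this cancels the loss in the exponent. Since
`μ` does not depend on the sample, Fubini applies. -/
theorem lintegral_exp_moment_le_one (hm : 1 ≤ m) (hp : 1 ≤ p) (hσ : 0 < σ) {α C : ℝ}
    (hα : 0 < α) (hα1 : α < 1) (hC : 0 < C) {M₀ : Matrix (Fin m) (Fin p) ℝ}
    (hM₀ : ∀ i j, |M₀ i j| ≤ C) (μ : Measure (Param m p K)) [IsProbabilityMeasure μ] :
    ∫⁻ x, ∫⁻ θ, ENNReal.ofReal (Real.exp
        (scaledLoss n C (α * (1 - α) / (2 * σ ^ 2)) M₀ θ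
          + α * (logLikelihood σ x θ.toMatrix - logLikelihood σ x M₀))) ∂μ ∂(sampleLaw n σ M₀)
      ≤ 1 := by
  have hP := isProbabilityMeasure_obsLaw hm hp σ M₀
  have : IsProbabilityMeasure (sampleLaw n σ M₀) := by unfold sampleLaw; infer_instance
  have hc : 0 ≤ α * (1 - α) / (2 * σ ^ 2) := by
    have : 0 ≤ 1 - α := by linarith
    positivity
  set c := α * (1 - α) / (2 * σ ^ 2) with hcdef
  have h1 : Measurable fun w : (Fin n → Obs m p) × Param m p K =>
      logLikelihood σ w.1 w.2.toMatrix :=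
    measurable_logLikelihood hσ measurable_fst fun i j =>
      (measurable_toMatrix_apply i j).comp measurable_snd
  have h2 : Measurable fun w : (Fin n → Obs m p) × Param m p K => logLikelihood σ w.1 M₀ :=
    measurable_logLikelihood hσ measurable_fst fun i j => measurable_const
  have h3 : Measurable fun w : (Fin n → Obs m p) × Param m p K => scaledLoss n C c M₀ w.2 :=
    (measurable_scaledLoss n C c M₀).comp measurable_snd
  rw [lintegral_lintegral_swap
    (h3.add ((h1.sub h2).const_mul α)).exp.ennreal_ofReal.aemeasurable]
  calc _ ≤ ∫⁻ _ : Param m p K, 1 ∂μ := lintegral_mono fun θ => ?_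
    _ = 1 := by simp
  simp_rw [Real.exp_add, ENNReal.ofReal_mul (Real.exp_pos _).le]
  rw [lintegral_const_mul' _ _ ENNReal.ofReal_ne_top,
    lintegral_exp_logLikelihood_sub hm hp hσ, ← hcdef]
  have h4 := mean_exp_le hm hp hC hc θ.toMatrix M₀ hM₀
  calc _ ≤ ENNReal.ofReal (Real.exp (scaledLoss n C c M₀ θ)) * ENNReal.ofReal (Real.exp
        (-(curv C c * (frobeniusSq (clip C θ.toMatrix - M₀) / ((m : ℝ) * p))))) ^ n := by gcongr
    _ = 1 := by
      rw [← ENNReal.ofReal_pow (Real.exp_pos _).le, ← Real.exp_nat_mul,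
        ← ENNReal.ofReal_mul (Real.exp_pos _).le, ← Real.exp_add, scaledLoss]
      ring_nf
      simp

variable (τ : Fin K → Measure ℝ) [∀ k, IsProbabilityMeasure (τ k)] (Ub : Fin m → Fin K → ℝ)
  (Vb : Fin p → Fin K → ℝ) {v : Fin K → ℝ}

/-- The mean squared error of the entry `z` of `U Vᵗ` under `refLaw`. -/
noncomputable def entryErr (Ub : Fin m → Fin K → ℝ) (Vb : Fin p → Fin K → ℝ) (v : Fin K → ℝ)
    (z : Fin m × Fin p) : ℝ :=
  ∑ k, (v k * (Ub z.1 k ^ 2 + Vb z.2 k ^ 2) + v k ^ 2)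

/-- The mean of `UVᵗ` is exactly `M₀`, so the cross term with the noise vanishes and only the
variance of the entry is lost. The identity holds for every observation, not merely in expectation.
-/
theorem integrable_and_integral_obsLog (hv : ∀ k, 0 < v k) {M₀ : Matrix (Fin m) (Fin p) ℝ}
    (hM₀ : ∀ i j, M₀ i j = ∑ k, Ub i k * Vb j k) (o : Obs m p) :
    Integrable (fun θ : Param m p K => obsLog σ θ.toMatrix o) (refLaw τ Ub Vb v) ∧
    ∫ θ : Param m p K, obsLog σ θ.toMatrix o ∂(refLaw τ Ub Vb v)
      = obsLog σ M₀ o - entryErr Ub Vb v o.1 / (2 * σ ^ 2) := by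
  obtain ⟨⟨i, j⟩, y⟩ := o
  have h : ∀ θ : Param m p K, obsLog σ θ.toMatrix ((i, j), y)
      = (-Real.log √(2 * Real.pi * σ ^ 2) - y ^ 2 / (2 * σ ^ 2))
        + (2 * y / (2 * σ ^ 2)) * θ.toMatrix i j - (1 / (2 * σ ^ 2)) * θ.toMatrix i j ^ 2 := by
    intro θ; simp only [obsLog]; ring
  have i1 := integrable_toMatrix_apply τ Ub Vb v i j
  have i2 := integrable_sq_toMatrix_apply τ Ub Vb v i j
  have i3 : Integrable (fun θ : Param m p K =>
      (-Real.log √(2 * Real.pi * σ ^ 2) - y ^ 2 / (2 * σ ^ 2))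
        + (2 * y / (2 * σ ^ 2)) * θ.toMatrix i j) (refLaw τ Ub Vb v) :=
    (integrable_const _).add (i1.const_mul _)
  simp_rw [h]
  refine ⟨i3.sub (i2.const_mul _), ?_⟩
  rw [integral_sub i3 (i2.const_mul _), integral_add (integrable_const _) (i1.const_mul _),
    integral_const_mul, integral_const_mul, integral_sq_toMatrix_apply _ _ _ _ hv,
    integral_toMatrix_apply, integral_const, probReal_univ, one_smul, ← hM₀]
  simp only [obsLog, entryErr]
  ring

theorem integrable_and_integral_logLikelihood (hσ : 0 < σ) (hv : ∀ k, 0 < v k)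
    {M₀ : Matrix (Fin m) (Fin p) ℝ} (hM₀ : ∀ i j, M₀ i j = ∑ k, Ub i k * Vb j k)
    (x : Fin n → Obs m p) :
    Integrable (fun θ : Param m p K => logLikelihood σ x θ.toMatrix) (refLaw τ Ub Vb v) ∧
    ∫ θ : Param m p K, logLikelihood σ x θ.toMatrix ∂(refLaw τ Ub Vb v)
      = logLikelihood σ x M₀ - ∑ k, entryErr Ub Vb v (x k).1 / (2 * σ ^ 2) := by
  have h := fun o => integrable_and_integral_obsLog (σ := σ) τ Ub Vb hv hM₀ o
  simp_rw [logLikelihood_eq hσ]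
  refine ⟨integrable_finsetSum _ fun k _ => (h (x k)).1, ?_⟩
  rw [integral_finsetSum _ fun k _ => (h (x k)).1, ← Finset.sum_sub_distrib]
  exact Finset.sum_congr rfl fun k _ => (h (x k)).2

theorem isProbabilityMeasure_of_mem_meanField {ρ : Measure (Param m p K)}
    (hρ : ρ ∈ meanField m p K) : IsProbabilityMeasure ρ := by
  obtain ⟨ρU, ρV, ργ, hU, hV, hγ, rfl⟩ := hρ
  infer_instance

/-- The exponential moment that appears in the risk bound. -/
noncomputable def expMoment (σ α C : ℝ) (μ : Measure (Param m p K))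
    (M₀ : Matrix (Fin m) (Fin p) ℝ) (x : Fin n → Obs m p) : ℝ≥0∞ :=
  ∫⁻ θ, ENNReal.ofReal (Real.exp
    (scaledLoss n C (α * (1 - α) / (2 * σ ^ 2)) M₀ θ
      + α * (logLikelihood σ x θ.toMatrix - logLikelihood σ x M₀))) ∂μ

/-- The Gibbs inequality, with the minimizer compared to the reference law, for one fixed sample.
Bounding `log` by `t - 1` here makes the right side linear in the moment, hence ready to be
averaged. -/
theorem integral_scaledLoss_le (hm : 1 ≤ m) (hp : 1 ≤ p) (hσ : 0 < σ) {α C a b : ℝ}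
    (ha : 0 < a) (hb : 0 < b) (hα : 0 < α) (hα1 : α < 1) (hC : 0 < C) (hv : ∀ k, 0 < v k)
    {M₀ : Matrix (Fin m) (Fin p) ℝ} (hM₀ : ∀ i j, M₀ i j = ∑ k, Ub i k * Vb j k)
    (hM₀C : ∀ i j, |M₀ i j| ≤ C) (hac : refLaw τ Ub Vb v ≪ prior m p K a b)
    (hint : Integrable (llr (refLaw τ Ub Vb v) (prior m p K a b)) (refLaw τ Ub Vb v))
    (x : Fin n → Obs m p) {ρ : Measure (Param m p K)} (hρ : IsVBApprox a b σ α x ρ) :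
    ∫ θ, scaledLoss n C (α * (1 - α) / (2 * σ ^ 2)) M₀ θ ∂ρ
      ≤ ∫ θ, llr (refLaw τ Ub Vb v) (prior m p K a b) θ ∂(refLaw τ Ub Vb v)
        + α / (2 * σ ^ 2) * ∑ k, entryErr Ub Vb v (x k).1
        + ((expMoment σ α C (prior m p K a b) M₀ x).toReal - 1) := by
  have hc : 0 < α * (1 - α) / (2 * σ ^ 2) := by
    have : 0 < 1 - α := by linarith
    positivity
  set c := α * (1 - α) / (2 * σ ^ 2) with hcdef
  have i1 := isProbabilityMeasure_prior (m := m) (p := p) (K := K) ha hb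
  have i2 := isProbabilityMeasure_of_mem_meanField hρ.2
  have hf := integrable_exp_logLikelihood hσ hα x (prior m p K a b)
  obtain ⟨hl1, hl2⟩ := integrable_and_integral_logLikelihood τ Ub Vb hσ hv hM₀ x
  have hg := measurable_scaledLoss (K := K) n C c M₀
  have hgb := abs_scaledLoss_le (K := K) hm hp n hC hc hM₀C
  have key := integral_le_of_klDiv_tilted_le hf hg hgb hac hint
    (hl1.const_mul α) (hρ.1 (refLaw_mem_meanField τ Ub Vb v))
  refine key.trans ?_
  rw [integral_const_mul, hl2]
  have hm1 : Measurable fun θ : Param m p K => logLikelihood σ x θ.toMatrix :=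
    measurable_logLikelihood hσ measurable_const measurable_toMatrix_apply
  set e : Param m p K → ℝ := fun θ => Real.exp (scaledLoss n C c M₀ θ
      + α * (logLikelihood σ x θ.toMatrix - logLikelihood σ x M₀)) with he
  have hem : Measurable e := (hg.add ((hm1.sub_const _).const_mul α)).exp
  have e1 : (expMoment σ α C (prior m p K a b) M₀ x).toReal
      = ∫ θ, e θ ∂(prior m p K a b) := by
    rw [expMoment, ← hcdef, integral_eq_lintegral_of_nonneg_ae
      (Filter.Eventually.of_forall fun θ => (Real.exp_pos _).le) hem.aestronglyMeasurable]
  -- The factor `exp(α ℓ(M₀))` pulled out here compensates the main term of `∫ ℓ` under the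
  -- reference law.
  have e2 : ∫ θ, Real.exp (α * logLikelihood σ x θ.toMatrix + scaledLoss n C c M₀ θ)
        ∂(prior m p K a b)
      = Real.exp (α * logLikelihood σ x M₀) * ∫ θ, e θ ∂(prior m p K a b) := by
    rw [← integral_const_mul]
    refine integral_congr_ae (Filter.Eventually.of_forall fun θ => ?_)
    simp only [he]
    rw [← Real.exp_add]
    congr 1
    ring
  have hei : Integrable e (prior m p K a b) := by
    have h1 : e = fun θ => (Real.exp (-(α * logLikelihood σ x M₀))
        * Real.exp (scaledLoss n C c M₀ θ)) * Real.exp (α * logLikelihood σ x θ.toMatrix) := by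
      funext θ
      simp only [he]
      rw [← Real.exp_add, ← Real.exp_add]
      congr 1
      ring
    rw [h1]
    refine hf.bdd_mul (c := Real.exp (-(α * logLikelihood σ x M₀)) *
      Real.exp (n * curv C c * (4 * C ^ 2)))
      (hg.exp.const_mul _).aestronglyMeasurable (Filter.Eventually.of_forall fun θ => ?_)
    rw [Real.norm_of_nonneg (by positivity)]
    have := (le_abs_self _).trans (hgb θ)
    gcongr
  have hpos : 0 < ∫ θ, e θ ∂(prior m p K a b) := integral_exp_pos hei
  rw [e1, e2, Real.log_mul (Real.exp_pos _).ne' hpos.ne', Real.log_exp, ← Finset.sum_div]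
  have := Real.log_le_sub_one_of_pos hpos
  have e3 : α * ((∑ k, entryErr Ub Vb v (x k).1) / (2 * σ ^ 2))
      = α / (2 * σ ^ 2) * ∑ k, entryErr Ub Vb v (x k).1 := by ring
  rw [mul_sub, e3]
  linarith

theorem integral_sum_sample (hm : 1 ≤ m) (hp : 1 ≤ p) (σ : ℝ) (M₀ : Matrix (Fin m) (Fin p) ℝ)
    (h : Fin m × Fin p → ℝ) :
    Integrable (fun x : Fin n → Obs m p => ∑ k, h (x k).1) (sampleLaw n σ M₀) ∧
    ∫ x : Fin n → Obs m p, ∑ k, h (x k).1 ∂(sampleLaw n σ M₀)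
      = n * (((m : ℝ) * p)⁻¹ * ∑ z, h z) := by
  have hP := isProbabilityMeasure_obsLaw hm hp σ M₀
  have hmeas : Measurable fun o : Obs m p => h o.1 :=
    (measurable_of_countable h).comp measurable_fst
  have hi : Integrable (fun o : Obs m p => h o.1) (obsLaw σ M₀) :=
    integrable_of_abs_le (c := ∑ w, |h w|) hmeas fun o =>
      Finset.single_le_sum (f := fun w => |h w|) (fun _ _ => abs_nonneg _) (Finset.mem_univ _)
  have hmp : ∀ k : Fin n, MeasurePreserving (fun x : Fin n → Obs m p => x k) (sampleLaw n σ M₀)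
      (obsLaw σ M₀) := fun k => measurePreserving_eval (fun _ : Fin n => obsLaw σ M₀) k
  have hik := fun k => integrable_comp_measurePreserving (hmp k) hi
  refine ⟨integrable_finsetSum _ fun k _ => hik k, ?_⟩
  rw [integral_finsetSum _ fun k _ => hik k]
  simp_rw [integral_comp_measurePreserving (hmp _) hi.1, integral_obsLaw_fst hm hp]
  simp

/-- The risk of a variational approximation is bounded by the divergence of a reference law from
the prior plus its mean squared error. -/
theorem lintegral_risk_le (hm : 1 ≤ m) (hp : 1 ≤ p) (hn : 1 ≤ n) (hσ : 0 < σ) {α C a b : ℝ}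
    (ha : 0 < a) (hb : 0 < b) (hα : 0 < α) (hα1 : α < 1) (hC : 0 < C) (hv : ∀ k, 0 < v k)
    {M₀ : Matrix (Fin m) (Fin p) ℝ} (hM₀ : ∀ i j, M₀ i j = ∑ k, Ub i k * Vb j k)
    (hM₀C : ∀ i j, |M₀ i j| ≤ C) (hac : refLaw τ Ub Vb v ≪ prior m p K a b)
    (hint : Integrable (llr (refLaw τ Ub Vb v) (prior m p K a b)) (refLaw τ Ub Vb v))
    {vb : (Fin n → Obs m p) → Measure (Param m p K)}
    (hvb : ∀ x, IsVBApprox a b σ α x (vb x)) :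
    ∫⁻ x, ∫⁻ θ, ENNReal.ofReal (frobeniusSq (clip C θ.toMatrix - M₀) / ((m : ℝ) * p)) ∂(vb x)
      ∂(sampleLaw n σ M₀)
    ≤ ENNReal.ofReal ((∫ θ, llr (refLaw τ Ub Vb v) (prior m p K a b) θ ∂(refLaw τ Ub Vb v)
        + α / (2 * σ ^ 2) * (n * (((m : ℝ) * p)⁻¹ * ∑ z, entryErr Ub Vb v z)))
        / (n * curv C (α * (1 - α) / (2 * σ ^ 2)))) := by
  have hc : 0 < α * (1 - α) / (2 * σ ^ 2) := by
    have : 0 < 1 - α := by linarith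
    positivity
  have hmoment := lintegral_exp_moment_le_one (n := n) (K := K) hm hp hσ hα hα1 hC hM₀C
  have hstep := fun x => integral_scaledLoss_le τ Ub Vb hm hp hσ ha hb hα hα1 hC hv hM₀ hM₀C
    hac hint x (hvb x)
  set c := α * (1 - α) / (2 * σ ^ 2) with hcdef
  set L := ∫ θ, llr (refLaw τ Ub Vb v) (prior m p K a b) θ ∂(refLaw τ Ub Vb v) with hL
  have i1 := isProbabilityMeasure_prior (m := m) (p := p) (K := K) ha hb
  have i2 := fun x => isProbabilityMeasure_of_mem_meanField (hvb x).2
  have hP := isProbabilityMeasure_obsLaw hm hp σ M₀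
  have i3 : IsProbabilityMeasure (sampleLaw n σ M₀) := by unfold sampleLaw; infer_instance
  have hnk : 0 < n * curv C c := mul_pos (by positivity) (curv_pos hC hc)
  let A : (Fin n → Obs m p) → ℝ := fun x =>
    L + α / (2 * σ ^ 2) * ∑ k, entryErr Ub Vb v (x k).1
      + ((expMoment σ α C (prior m p K a b) M₀ x).toReal - 1)
  have hmom : ∫⁻ x, expMoment σ α C (prior m p K a b) M₀ x ∂(sampleLaw n σ M₀) ≤ 1 :=
    hmoment (prior m p K a b)
  have hmomtop := ne_top_of_le_ne_top ENNReal.one_ne_top hmom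
  have hmm : Measurable (expMoment (n := n) σ α C (prior m p K a b) M₀) := by
    have h1 : Measurable fun w : (Fin n → Obs m p) × Param m p K =>
        logLikelihood σ w.1 w.2.toMatrix :=
      measurable_logLikelihood hσ measurable_fst fun i j =>
        (measurable_toMatrix_apply i j).comp measurable_snd
    have h2 : Measurable fun w : (Fin n → Obs m p) × Param m p K => logLikelihood σ w.1 M₀ :=
      measurable_logLikelihood hσ measurable_fst fun i j => measurable_const
    have h3 : Measurable fun w : (Fin n → Obs m p) × Param m p K => scaledLoss n C c M₀ w.2 :=
      (measurable_scaledLoss n C c M₀).comp measurable_snd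
    exact (h3.add ((h1.sub h2).const_mul α)).exp.ennreal_ofReal.lintegral_prod_right'
  obtain ⟨s1, s2⟩ := integral_sum_sample (n := n) hm hp σ M₀ (entryErr Ub Vb v)
  have s3 : Integrable (fun x => (expMoment σ α C (prior m p K a b) M₀ x).toReal)
      (sampleLaw n σ M₀) := integrable_toReal_of_lintegral_ne_top hmm.aemeasurable hmomtop
  have s4 : ∫ x, (expMoment σ α C (prior m p K a b) M₀ x).toReal ∂(sampleLaw n σ M₀) ≤ 1 := by
    rw [integral_toReal hmm.aemeasurable (ae_lt_top hmm hmomtop)]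
    exact ENNReal.toReal_le_of_le_ofReal zero_le_one (by simpa using hmom)
  have t1 : Integrable (fun x : Fin n → Obs m p =>
      L + α / (2 * σ ^ 2) * ∑ k, entryErr Ub Vb v (x k).1) (sampleLaw n σ M₀) :=
    (integrable_const _).add (s1.const_mul _)
  have t2 : Integrable (fun x => (expMoment σ α C (prior m p K a b) M₀ x).toReal - 1)
      (sampleLaw n σ M₀) := s3.sub (integrable_const _)
  have hA : Integrable A (sampleLaw n σ M₀) := t1.add t2
  have hAint : ∫ x, A x ∂(sampleLaw n σ M₀)
      ≤ L + α / (2 * σ ^ 2) * (n * (((m : ℝ) * p)⁻¹ * ∑ z, entryErr Ub Vb v z)) := by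
    have : ∫ x, A x ∂(sampleLaw n σ M₀)
        = (L + α / (2 * σ ^ 2) * (n * (((m : ℝ) * p)⁻¹ * ∑ z, entryErr Ub Vb v z)))
          + (∫ x, (expMoment σ α C (prior m p K a b) M₀ x).toReal ∂(sampleLaw n σ M₀) - 1) := by
      refine (integral_add t1 t2).trans ?_
      rw [integral_add (integrable_const _) (s1.const_mul _), integral_const_mul, s2,
        integral_sub s3 (integrable_const _)]
      simp
    linarith
  -- `A x` dominates the integral of a nonnegative loss; this allows passing between real and
  -- extended integrals.
  have hA0 : ∀ x, 0 ≤ A x := fun x => (integral_nonneg fun θ => by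
    have := frobeniusSq_nonneg (clip C θ.toMatrix - M₀)
    rw [Pi.zero_apply, scaledLoss]
    positivity).trans (hstep x)
  have hpt : ∀ x, ∫⁻ θ, ENNReal.ofReal
      (frobeniusSq (clip C θ.toMatrix - M₀) / ((m : ℝ) * p)) ∂(vb x)
      ≤ ENNReal.ofReal (A x / (n * curv C c)) := by
    intro x
    have hgi : Integrable (scaledLoss n C c M₀) (vb x) :=
      integrable_of_abs_le (measurable_scaledLoss n C c M₀) (abs_scaledLoss_le hm hp n hC hc hM₀C)
    have hfi : Integrable (fun θ : Param m p K =>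
        frobeniusSq (clip C θ.toMatrix - M₀) / ((m : ℝ) * p)) (vb x) := by
      refine (hgi.const_mul (n * curv C c)⁻¹).congr (Filter.Eventually.of_forall fun θ => ?_)
      simp only [scaledLoss]
      rw [inv_mul_cancel_left₀ hnk.ne']
    rw [← ofReal_integral_eq_lintegral_ofReal hfi (Filter.Eventually.of_forall fun θ =>
      div_nonneg (frobeniusSq_nonneg _) (by positivity))]
    refine ENNReal.ofReal_le_ofReal ?_
    rw [le_div_iff₀ hnk, mul_comm, ← integral_const_mul]
    exact hstep x
  -- Monotonicity of the lower integral asks for no measurability of `x ↦ vb x`, so any selection of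
  -- minimizers is covered.
  calc _ ≤ ∫⁻ x, ENNReal.ofReal (A x / (n * curv C c)) ∂(sampleLaw n σ M₀) := lintegral_mono hpt
    _ = ENNReal.ofReal (∫ x, A x / (n * curv C c) ∂(sampleLaw n σ M₀)) :=
        (ofReal_integral_eq_lintegral_ofReal (hA.div_const _)
          (Filter.Eventually.of_forall fun x => div_nonneg (hA0 x) hnk.le)).symm
    _ ≤ _ := by
        rw [integral_div]
        exact ENNReal.ofReal_le_ofReal (by gcongr)

end Risk

/-! ### Numerical bounds for the choice of the reference law -/

section Bounds

theorem sum_fin_le_of_split {r K : ℕ} (hrK : r ≤ K) {f : Fin K → ℝ} {x y : ℝ}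
    (hx : ∀ k : Fin K, (k : ℕ) < r → f k ≤ x) (hy : ∀ k : Fin K, r ≤ (k : ℕ) → f k ≤ y) :
    ∑ k, f k ≤ r * x + ((K : ℝ) - r) * y := by
  obtain ⟨d, rfl⟩ := Nat.exists_eq_add_of_le hrK
  rw [Fin.sum_univ_add]
  have h1 := Finset.sum_le_card_nsmul Finset.univ (fun i : Fin r => f (Fin.castAdd d i)) x
    fun i _ => hx _ (by simp)
  have h2 := Finset.sum_le_card_nsmul Finset.univ (fun i : Fin d => f (Fin.natAdd r i)) y
    fun i _ => hy _ (by simp)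
  simp only [Finset.card_univ, Fintype.card_fin, nsmul_eq_mul] at h1 h2
  push_cast
  linarith

/-- The final comparison of the divergence of the reference law with the announced bound. -/
theorem divergence_arith {r K S a L G l ℓ : ℝ} (hr : 1 ≤ r) (hrK : r ≤ K) (hKS : 2 * K ≤ S)
    (ha : 0 < a) (hL : 0 ≤ L) (hl : 0.69 ≤ l) (hG : -(2 + l) ≤ G) (hℓ : 0 ≤ ℓ) :
    r * (l + a * (10 * l + 6 * L) + 1 + G) + r * S * (2 * L + l - 1 / 2 * ℓ + 1 / 2)
        + (K - r) * (ℓ + 2 + G) + (K - r) / 2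
      ≤ 2 * (1 + 2 * a) * r * S * (L + G + (10 * a + 4) * l + 3) := by
  -- The shift makes the log-gamma term nonnegative, so that its coefficients on the two sides can
  -- be compared.
  obtain ⟨G', rfl⟩ : ∃ G', G = G' - (2 + l) := ⟨G + (2 + l), by ring⟩
  have hG' : 0 ≤ G' := by linarith
  set W := r * S with hW
  have hSW : S ≤ W := by nlinarith
  have hrW : 2 * r ≤ W := by nlinarith
  have hW0 : 0 < W := by linarith
  have hl0 : 0 < l := by linarith
  -- The cost `ℓ = log S` of the null columns is absorbed by the `-W/2 * ℓ` coming from the signal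
  -- variance; this uses `K ≤ S/2 ≤ W/2`.
  have e1 : (K - r) * ℓ ≤ W / 2 * ℓ := mul_le_mul_of_nonneg_right (by linarith) hℓ
  have e2 : r * (a * (10 * l + 6 * L)) ≤ W / 2 * (a * (10 * l + 6 * L)) :=
    mul_le_mul_of_nonneg_right (by linarith) (by positivity)
  have e3 : K * G' ≤ W / 2 * G' := mul_le_mul_of_nonneg_right (by linarith) hG'
  have e4 : r * (l + 1) ≤ W / 2 * (l + 1) := mul_le_mul_of_nonneg_right (by linarith) (by linarith)
  have e5 : (K - r) * (5 / 2) ≤ W / 2 * (5 / 2) :=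
    mul_le_mul_of_nonneg_right (by linarith) (by norm_num)
  have e6 : 0 ≤ K * (2 + l) := mul_nonneg (by linarith) (by linarith)
  have f1 : 0 ≤ W * (a * L) := by positivity
  have f2 : 0 ≤ W * (a * l) := by positivity
  have f3 : 0 ≤ W * (a * a * l) := by positivity
  have f4 : 0 ≤ W * G' := by positivity
  have f5 : 0 ≤ W * (a * G') := by positivity
  -- The numerical value of `log 2` absorbs the leftover constant multiple of `W`.
  have f6 : W * 0.69 ≤ W * l := mul_le_mul_of_nonneg_left hl hW0.le
  have f7 : 0 ≤ W * a := by positivity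
  have lhs : r * (l + a * (10 * l + 6 * L) + 1 + (G' - (2 + l)))
        + W * (2 * L + l - 1 / 2 * ℓ + 1 / 2)
        + (K - r) * (ℓ + 2 + (G' - (2 + l))) + (K - r) / 2
      = r * (l + 1) + r * (a * (10 * l + 6 * L)) + (K - r) * ℓ + K * G' - K * (2 + l)
        + (K - r) * (5 / 2) + W * (2 * L + l + 1 / 2) - W / 2 * ℓ := by ring
  have rhs : 2 * (1 + 2 * a) * r * S * (L + (G' - (2 + l)) + (10 * a + 4) * l + 3)
      = 2 * W * L + 2 * W * G' + 6 * (W * l) + 2 * W + 4 * (W * (a * L)) + 4 * (W * (a * G'))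
        + 32 * (W * (a * l)) + 40 * (W * (a * a * l)) + 4 * (W * a) := by
    rw [hW]; ring
  rw [lhs, rhs]
  nlinarith

theorem log_const_bounds {a : ℝ} (ha : 0 < a) :
    Real.log (Real.Gamma a) + (10 * a + 4) * Real.log 2 + 3 ≤ constC a := by
  have hΓ := Real.Gamma_pos_of_pos ha
  have hπ : 0 ≤ Real.log √Real.pi := Real.log_nonneg (by
    rw [Real.one_le_sqrt]; linarith [Real.pi_gt_three])
  have h8 : Real.log 8 = 3 * Real.log 2 := by
    rw [show (8 : ℝ) = 2 ^ 3 by norm_num, Real.log_pow]; norm_num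
  rw [constC, Real.log_mul (by positivity) (by positivity),
    Real.log_mul (by positivity) hΓ.ne', Real.log_mul (by norm_num) (by positivity),
    Real.log_rpow (by norm_num), h8]
  linarith

variable {B N X S b : ℝ}

theorem bChoice_bounds (hB : 0 < B) (hN : 1 ≤ N) (hX : 1 ≤ X) (hXN : X ≤ N)
    (hb : b = B ^ 2 / (512 * N ^ 4 * X ^ 2)) :
    0 < b ∧ b ≤ B ^ 2 / (512 * N ^ 4) ∧
      Real.log (2 * B ^ 2 / b) ≤ 10 * Real.log 2 + 6 * Real.log N := by
  have hN0 : 0 < N := by linarith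
  have hX0 : 0 < X := by linarith
  refine ⟨by rw [hb]; positivity, ?_, ?_⟩
  · rw [hb]
    have : 512 * N ^ 4 * 1 ≤ 512 * N ^ 4 * X ^ 2 :=
      mul_le_mul_of_nonneg_left (one_le_pow₀ hX) (by positivity)
    rw [mul_one] at this
    gcongr
  · have e : 2 * B ^ 2 / b = 2 ^ 10 * (N ^ 4 * X ^ 2) := by
      rw [hb]; field_simp; norm_num
    rw [e, Real.log_mul (by positivity) (by positivity), Real.log_mul (by positivity)
      (by positivity), Real.log_pow, Real.log_pow, Real.log_pow]
    have := Real.log_le_log hX0 hXN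
    push_cast
    linarith

/-- The variance is at most `B²` since `S ≤ 2N⁴`, so the quadratic part costs at most `1`; half the
log of the variance ratio `4N⁴/S` gives the rest. -/
theorem entryCost_signal_le (hB : 0 < B) (hN : 1 ≤ N) (hS : 0 < S) (hSN : S ≤ 2 * N ^ 4)
    {c : ℝ} (hc : |c| ≤ B) :
    entryCost (B ^ 2) (2 * B ^ 2) (S / (2 * N ^ 4) * B ^ 2) c
      ≤ 2 * Real.log N + Real.log 2 - 1 / 2 * Real.log S + 1 / 2 := by
  have hN0 : 0 < N := by linarith
  have e1 : 2 * B ^ 2 / (S / (2 * N ^ 4) * B ^ 2) = 2 ^ 2 * N ^ 4 / S := by field_simp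
  have h1 : S / (2 * N ^ 4) ≤ 1 := (div_le_one (by positivity)).2 hSN
  have h2 : c ^ 2 ≤ B ^ 2 := sq_le_sq.2 (by rwa [abs_of_pos hB])
  have e2 : 1 / (2 * B ^ 2) * (S / (2 * N ^ 4) * B ^ 2 + c ^ 2) ≤ 1 := by
    rw [one_div_mul_eq_div, div_le_one (by positivity)]
    have := mul_le_mul_of_nonneg_right h1 (sq_nonneg B)
    linarith
  rw [entryCost, e1, Real.log_div (by positivity) hS.ne', Real.log_mul (by positivity)
    (by positivity), Real.log_pow, Real.log_pow]
  push_cast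
  linarith

/-- Equal upper endpoint and variance kill the logarithm, and the relative width `1/S` of the
interval leaves only `1/(2S)`, harmless after summing over `S` rows. -/
theorem entryCost_null_eq (hb : 0 < b) (hS : 0 < S) :
    entryCost (b / (1 + 1 / S)) b b 0 = 1 / (2 * S) := by
  rw [entryCost, div_self hb.ne', Real.log_one]
  field_simp
  ring

theorem signal_mass {a : ℝ} (ha : 0 < a) (hB : 0 < B) (hN : 1 ≤ N) (hX : 1 ≤ X) (hXN : X ≤ N)
    (hb : b = B ^ 2 / (512 * N ^ 4 * X ^ 2)) :
    0 < (invGammaMeasure a b).real (Set.Icc (B ^ 2) (2 * B ^ 2)) ∧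
    -Real.log ((invGammaMeasure a b).real (Set.Icc (B ^ 2) (2 * B ^ 2)))
      ≤ Real.log 2 + a * (10 * Real.log 2 + 6 * Real.log N) + 1 + Real.log (Real.Gamma a) := by
  obtain ⟨hb0, hb1, hb2⟩ := bChoice_bounds hB hN hX hXN hb
  have hB2 : 0 < B ^ 2 := by positivity
  obtain ⟨h1, h2⟩ := neg_log_invGammaMeasure_le ha hb0 hB2 (by linarith : B ^ 2 < 2 * B ^ 2)
  refine ⟨h1, h2.trans ?_⟩
  have e1 : 2 * B ^ 2 / (2 * B ^ 2 - B ^ 2) = 2 := by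
    rw [div_eq_iff (by linarith)]; ring
  have e2 : b / B ^ 2 ≤ 1 := by
    rw [div_le_one hB2]
    refine hb1.trans (div_le_self hB2.le ?_)
    have := one_le_pow₀ hN (n := 4)
    linarith
  have e3 := mul_le_mul_of_nonneg_left hb2 ha.le
  rw [e1]
  linarith

/-- With upper endpoint `b` the term in `a` disappears. The narrow interval costs `log S + log(1 +
1/S)`, the exponential costs `1 + 1/S`, and `1/S ≤ 1/2` gives the `2`. -/
theorem null_mass {a : ℝ} (ha : 0 < a) (hb : 0 < b) (hS : 2 ≤ S) :
    0 < (invGammaMeasure a b).real (Set.Icc (b / (1 + 1 / S)) b) ∧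
    -Real.log ((invGammaMeasure a b).real (Set.Icc (b / (1 + 1 / S)) b))
      ≤ Real.log S + 2 + Real.log (Real.Gamma a) := by
  have hS0 : 0 < S := by linarith
  have hlo : 0 < b / (1 + 1 / S) := by positivity
  have hlt : b / (1 + 1 / S) < b := div_lt_self hb (by
    have : 0 < 1 / S := by positivity
    linarith)
  obtain ⟨h1, h2⟩ := neg_log_invGammaMeasure_le ha hb hlo hlt
  refine ⟨h1, h2.trans ?_⟩
  have e1 : b / (b - b / (1 + 1 / S)) = S * (1 + 1 / S) := by
    rw [div_eq_iff (sub_pos.2 hlt).ne']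
    field_simp
    ring
  have e2 : b / (b / (1 + 1 / S)) = 1 + 1 / S := by field_simp
  have e3 : 1 / S ≤ 1 / 2 := one_div_le_one_div_of_le (by norm_num) hS
  have e4 := Real.log_le_sub_one_of_pos (by positivity : 0 < 1 + 1 / S)
  rw [e1, e2, div_self hb.ne', Real.log_one, Real.log_mul hS0.ne' (by positivity)]
  linarith

theorem error_arith {r K : ℝ} (hB : 0 < B) (hN : 1 ≤ N) (hr : 1 ≤ r) (hrK : r ≤ K)
    (hKS : 2 * K ≤ S) (hSN : S ≤ 2 * N ^ 4) (hb0 : 0 < b) (hb : b ≤ B ^ 2 / (512 * N ^ 4)) :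
    N * (r * (S / (2 * N ^ 4) * B ^ 2 * (B ^ 2 + B ^ 2) + (S / (2 * N ^ 4) * B ^ 2) ^ 2)
        + (K - r) * b ^ 2)
      ≤ 2 * r * S * (B * max 1 ((B / N) ^ 3)) := by
  have hN0 : 0 < N := by linarith
  have hS0 : 0 < S := by linarith
  have hN4 : 1 ≤ N ^ 4 := one_le_pow₀ hN
  have hmax : B ^ 4 / N ^ 3 ≤ B * max 1 ((B / N) ^ 3) := by
    have := mul_le_mul_of_nonneg_left (le_max_right 1 ((B / N) ^ 3)) hB.le
    refine le_trans (le_of_eq ?_) this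
    field_simp
  have hc : S / (2 * N ^ 4) ≤ 1 := (div_le_one (by positivity)).2 hSN
  have hc0 : 0 < S / (2 * N ^ 4) := by positivity
  set c := S / (2 * N ^ 4) with hcdef
  -- With this substitution the target becomes four times `N * r * c * B ^ 4`; the signal columns
  -- use three of these and the null columns a quarter.
  have hcS : S = c * (2 * N ^ 4) := by rw [hcdef]; field_simp
  have hb2 : b ^ 2 ≤ B ^ 4 / N ^ 4 / 4 := by
    have h1 : b ≤ B ^ 2 / N ^ 4 / 2 := by
      refine hb.trans ?_
      rw [div_div]
      refine div_le_div_of_nonneg_left (by positivity) (by positivity) ?_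
      linarith
    calc b ^ 2 ≤ (B ^ 2 / N ^ 4 / 2) ^ 2 := by gcongr
      _ = B ^ 4 / N ^ 4 / 4 / N ^ 4 := by field_simp; norm_num
      _ ≤ B ^ 4 / N ^ 4 / 4 := div_le_self (by positivity) hN4
  have h3 : c ^ 2 ≤ c := by nlinarith
  have h4 : (K - r) * b ^ 2 ≤ r * c * B ^ 4 / 4 := by
    have h5 : K - r ≤ r * S / 2 := by nlinarith
    calc (K - r) * b ^ 2 ≤ r * S / 2 * (B ^ 4 / N ^ 4 / 4) :=
          mul_le_mul h5 hb2 (sq_nonneg b) (by positivity)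
      _ = r * c * B ^ 4 / 4 := by rw [hcdef]; field_simp
  calc N * (r * (c * B ^ 2 * (B ^ 2 + B ^ 2) + (c * B ^ 2) ^ 2) + (K - r) * b ^ 2)
      ≤ N * (r * (2 * c * B ^ 4 + c * B ^ 4) + r * c * B ^ 4 / 4) := by
        have h6 : c ^ 2 * B ^ 4 ≤ c * B ^ 4 := mul_le_mul_of_nonneg_right h3 (by positivity)
        have h7 : c * B ^ 2 * (B ^ 2 + B ^ 2) + (c * B ^ 2) ^ 2
            = 2 * c * B ^ 4 + c ^ 2 * B ^ 4 := by ring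
        rw [h7]
        gcongr
    _ ≤ 2 * r * S * (B ^ 4 / N ^ 3) := by
        have h8 : 2 * r * S * (B ^ 4 / N ^ 3) = 4 * (N * (r * c * B ^ 4)) := by
          rw [hcS]; field_simp; ring
        have h9 : 0 ≤ N * (r * c * B ^ 4) := by positivity
        rw [h8]
        linarith
    _ ≤ _ := by gcongr

end Bounds

/-! ### Construction of the reference law and conclusion -/

section Main

/-- A function of the column index that takes one value on the first `r` columns and another
value on the remaining ones. -/
noncomputable def columnSplit {K : ℕ} (r : ℕ) (x y : ℝ) (k : Fin K) : ℝ :=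
  if (k : ℕ) < r then x else y

theorem columnSplit_pos {K r : ℕ} {x y : ℝ} (hx : 0 < x) (hy : 0 < y) (k : Fin K) :
    0 < columnSplit r x y k := by
  unfold columnSplit; split_ifs <;> assumption

theorem columnSplit_of_lt {K r : ℕ} {x y : ℝ} {k : Fin K}
    (h : (k : ℕ) < r) : columnSplit r x y k = x :=
  if_pos h

theorem columnSplit_of_le {K r : ℕ} {x y : ℝ} {k : Fin K}
    (h : r ≤ (k : ℕ)) : columnSplit r x y k = y :=
  if_neg (not_lt.2 h)

/-- A mean-field law close to a given factorization: its divergence from the prior and its mean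
squared error are both small. -/
theorem exists_reference {n m p K r : ℕ} (hn : 1 ≤ n) (hr : 1 ≤ r) (hrK : r ≤ K)
    (hK : K ≤ min m p) {a B : ℝ} (ha : 0 < a) (hB : 0 < B)
    {Ub : Fin m → Fin K → ℝ} {Vb : Fin p → Fin K → ℝ}
    (hU0 : ∀ i (l : Fin K), r ≤ (l : ℕ) → Ub i l = 0) (hUB : ∀ i l, |Ub i l| ≤ B)
    (hV0 : ∀ j (l : Fin K), r ≤ (l : ℕ) → Vb j l = 0) (hVB : ∀ j l, |Vb j l| ≤ B) :
    ∃ (τ : Fin K → Measure ℝ) (_ : ∀ k, IsProbabilityMeasure (τ k)) (v : Fin K → ℝ),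
      (∀ k, 0 < v k) ∧ refLaw τ Ub Vb v ≪ prior m p K a (bChoice n m p K B) ∧
      Integrable (llr (refLaw τ Ub Vb v) (prior m p K a (bChoice n m p K B)))
        (refLaw τ Ub Vb v) ∧
      ∫ θ, llr (refLaw τ Ub Vb v) (prior m p K a (bChoice n m p K B)) θ ∂(refLaw τ Ub Vb v)
        ≤ 2 * (1 + 2 * a) * r * ((m : ℝ) + p)
          * (Real.log ((n : ℝ) * m * p) + constC a) ∧
      n * ∑ z, entryErr Ub Vb v z
        ≤ 2 * r * ((m : ℝ) + p) * (B * max 1 ((B / ((n : ℝ) * m * p)) ^ 3)) := by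
  have hKm : K ≤ m := hK.trans (min_le_left _ _)
  have hKp : K ≤ p := hK.trans (min_le_right _ _)
  have hm : 1 ≤ m := by omega
  have hp : 1 ≤ p := by omega
  have hn' : (1 : ℝ) ≤ n := by exact_mod_cast hn
  have hm' : (1 : ℝ) ≤ m := by exact_mod_cast hm
  have hp' : (1 : ℝ) ≤ p := by exact_mod_cast hp
  have hr' : (1 : ℝ) ≤ r := by exact_mod_cast hr
  have hrK' : (r : ℝ) ≤ K := by exact_mod_cast hrK
  have hKS : 2 * (K : ℝ) ≤ (m : ℝ) + p := by
    have h1 : (K : ℝ) ≤ m := by exact_mod_cast hKm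
    have h2 : (K : ℝ) ≤ p := by exact_mod_cast hKp
    linarith
  set N : ℝ := (n : ℝ) * m * p with hNdef
  set S : ℝ := (m : ℝ) + p with hSdef
  set X : ℝ := ((max m p : ℕ) : ℝ) * K with hXdef
  set b : ℝ := bChoice n m p K B with hbdef
  have hmp : (m : ℝ) * p ≤ N := by
    have : 1 * ((m : ℝ) * p) ≤ n * ((m : ℝ) * p) :=
      mul_le_mul_of_nonneg_right hn' (by positivity)
    rw [hNdef]; linarith
  have hN : 1 ≤ N := (one_le_mul_of_one_le_of_one_le hm' hp').trans hmp
  have hX : 1 ≤ X := by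
    have h : 1 ≤ max m p * K := Nat.mul_pos (by omega) (by omega)
    rw [hXdef]; exact_mod_cast h
  -- Here `K ≤ min m p` enters, through `max m p * min m p = m * p`.
  have hXN : X ≤ N := by
    have h : max m p * K ≤ m * p := (Nat.mul_le_mul_left _ hK).trans_eq (max_mul_min m p)
    have h' : X ≤ (m : ℝ) * p := by rw [hXdef]; exact_mod_cast h
    exact h'.trans hmp
  have hS2 : 2 ≤ S := by linarith
  have hS0 : 0 < S := by linarith
  have hSN : S ≤ 2 * N ^ 4 := by
    have h1 : S ≤ 2 * ((m : ℝ) * p) := by rw [hSdef]; nlinarith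
    have h2 : N ≤ N ^ 4 := le_self_pow₀ hN (by norm_num)
    linarith
  have hbeq : b = B ^ 2 / (512 * N ^ 4 * X ^ 2) := rfl
  obtain ⟨hb0, hb1, -⟩ := bChoice_bounds hB hN hX hXN hbeq
  obtain ⟨hq1, hq1'⟩ := signal_mass ha hB hN hX hXN hbeq
  obtain ⟨hq2, hq2'⟩ := null_mass ha hb0 hS2
  have hP := isProbabilityMeasure_invGammaMeasure ha hb0
  have hprior := isProbabilityMeasure_prior (m := m) (p := p) (K := K) ha hb0
  have hB2 : 0 < B ^ 2 := by positivity
  -- Signal columns get variances of the order of the squared entries; null columns get the small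
  -- scale `b` of the prior, in an interval whose relative width matches the number `S` of rows.
  set lo : Fin K → ℝ := columnSplit r (B ^ 2) (b / (1 + 1 / S)) with hlo
  set hi : Fin K → ℝ := columnSplit r (2 * B ^ 2) b with hhi
  set v : Fin K → ℝ := columnSplit r (S / (2 * N ^ 4) * B ^ 2) b with hv
  have hlo0 : ∀ k, 0 < lo k := columnSplit_pos hB2 (by positivity)
  have hv0 : ∀ k, 0 < v k := columnSplit_pos (by positivity) hb0
  have hq : ∀ k, 0 < (invGammaMeasure a b).real (Set.Icc (lo k) (hi k)) := by
    intro k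
    rcases lt_or_ge (k : ℕ) r with hk | hk
    · rw [hlo, hhi, columnSplit_of_lt hk, columnSplit_of_lt hk]; exact hq1
    · rw [hlo, hhi, columnSplit_of_le hk, columnSplit_of_le hk]; exact hq2
  have hcond : ∀ k, IsProbabilityMeasure ((invGammaMeasure a b)[|Set.Icc (lo k) (hi k)]) := by
    intro k
    refine cond_isProbabilityMeasure fun h0 => ?_
    have := hq k
    simp [Measure.real, h0] at this
  have hdens := refLaw_eq_withDensity ha hb0 hlo0 hv0 hq Ub Vb
  obtain ⟨hac, hllr, hmem⟩ := llr_of_eq_withDensity_exp (measurableSet_varianceBox lo hi)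
    (measurable_refLogDensity _ Ub Vb v) hdens
  obtain ⟨hint, hle⟩ := integrable_refLogDensity_and_le
    (fun k => (invGammaMeasure a b)[|Set.Icc (lo k) (hi k)]) Ub Vb v
    (fun k => (invGammaMeasure a b).real (Set.Icc (lo k) (hi k))) hlo0 hv0 hmem
  refine ⟨fun k => (invGammaMeasure a b)[|Set.Icc (lo k) (hi k)], hcond, v, hv0, hac,
    hint.congr hllr.symm, ?_, ?_⟩
  · rw [integral_congr_ae hllr]
    refine hle.trans ?_
    have c1 := sum_fin_le_of_split hrK
      (x := Real.log 2 + a * (10 * Real.log 2 + 6 * Real.log N) + 1 + Real.log (Real.Gamma a))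
      (y := Real.log S + 2 + Real.log (Real.Gamma a))
      (f := fun k => -Real.log ((invGammaMeasure a b).real (Set.Icc (lo k) (hi k))))
      (fun k hk => by rw [hlo, hhi, columnSplit_of_lt hk, columnSplit_of_lt hk]; exact hq1')
      (fun k hk => by rw [hlo, hhi, columnSplit_of_le hk, columnSplit_of_le hk]; exact hq2')
    have c2 : ∀ w : Fin K → ℝ, (∀ l : Fin K, r ≤ (l : ℕ) → w l = 0) → (∀ l, |w l| ≤ B) →
        ∑ k, entryCost (lo k) (hi k) (v k) (w k)
          ≤ r * (2 * Real.log N + Real.log 2 - 1 / 2 * Real.log S + 1 / 2)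
            + ((K : ℝ) - r) * (1 / (2 * S)) := fun w h0 hw =>
      sum_fin_le_of_split hrK
        (fun k hk => by
          rw [hlo, hhi, hv, columnSplit_of_lt hk, columnSplit_of_lt hk, columnSplit_of_lt hk]
          exact entryCost_signal_le hB hN hS0 hSN (hw k))
        (fun k hk => by
          rw [hlo, hhi, hv, columnSplit_of_le hk, columnSplit_of_le hk, columnSplit_of_le hk, h0 k hk]
          exact (entryCost_null_eq hb0 hS0).le)
    have c3 := Finset.sum_le_card_nsmul Finset.univ _ _ fun i (_ : i ∈ Finset.univ) =>
      c2 (Ub i) (hU0 i) (hUB i)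
    have c4 := Finset.sum_le_card_nsmul Finset.univ _ _ fun j (_ : j ∈ Finset.univ) =>
      c2 (Vb j) (hV0 j) (hVB j)
    simp only [Finset.card_univ, Fintype.card_fin, nsmul_eq_mul] at c3 c4
    set E := (r : ℝ) * (2 * Real.log N + Real.log 2 - 1 / 2 * Real.log S + 1 / 2)
            + ((K : ℝ) - r) * (1 / (2 * S)) with hE
    have c5 : (m : ℝ) * E + p * E
        = r * S * (2 * Real.log N + Real.log 2 - 1 / 2 * Real.log S + 1 / 2)
          + ((K : ℝ) - r) / 2 := by
      rw [← add_mul, ← hSdef, hE]; field_simp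
    have c6 := divergence_arith hr' hrK' hKS ha (Real.log_nonneg hN)
      (by linarith [Real.log_two_gt_d9] : 0.69 ≤ Real.log 2)
      (neg_two_add_log_two_le_log_Gamma ha) (Real.log_nonneg (by linarith : 1 ≤ S))
    have c7 := log_const_bounds ha
    have c8 : 2 * (1 + 2 * a) * r * S * (Real.log N + Real.log (Real.Gamma a)
          + (10 * a + 4) * Real.log 2 + 3)
        ≤ 2 * (1 + 2 * a) * r * S * (Real.log N + constC a) :=
      mul_le_mul_of_nonneg_left (by linarith) (by positivity)
    linarith
  · have d1 : ∀ z : Fin m × Fin p, entryErr Ub Vb v z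
        ≤ r * (S / (2 * N ^ 4) * B ^ 2 * (B ^ 2 + B ^ 2) + (S / (2 * N ^ 4) * B ^ 2) ^ 2)
          + ((K : ℝ) - r) * b ^ 2 := by
      intro z
      refine sum_fin_le_of_split hrK (fun k hk => ?_) fun k hk => ?_
      · have h1 : Ub z.1 k ^ 2 ≤ B ^ 2 := sq_le_sq.2 (by rw [abs_of_pos hB]; exact hUB _ _)
        have h2 : Vb z.2 k ^ 2 ≤ B ^ 2 := sq_le_sq.2 (by rw [abs_of_pos hB]; exact hVB _ _)
        rw [hv, columnSplit_of_lt hk]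
        gcongr
      · rw [hv, columnSplit_of_le hk, hU0 _ _ hk, hV0 _ _ hk]
        exact le_of_eq (by ring)
    have d2 := Finset.sum_le_card_nsmul Finset.univ _ _ fun z (_ : z ∈ Finset.univ) => d1 z
    simp only [Finset.card_univ, Fintype.card_prod, Fintype.card_fin, nsmul_eq_mul,
      Nat.cast_mul] at d2
    have d3 := mul_le_mul_of_nonneg_left d2 (by positivity : (0 : ℝ) ≤ n)
    refine (d3.trans_eq ?_).trans (error_arith hB hN hr' hrK' hKS hSN hb0 hb1)
    rw [← mul_assoc, ← mul_assoc, ← hNdef]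

end Main

end MatrixCompletionVB

theorem mainTheorem11
    (n m p K r : ℕ) (hn : 1 ≤ n) (hr : 1 ≤ r) (hrK : r ≤ K) (hK : K ≤ min m p)
    (a B C σ α : ℝ) (ha : 0 < a) (hB : 0 < B) (hC : 0 < C) (hσ : 0 < σ)
    (hα : 0 < α) (hα1 : α < 1)
    (M₀ : Matrix (Fin m) (Fin p) ℝ)
    (Ubar : Matrix (Fin m) (Fin K) ℝ) (Vbar : Matrix (Fin p) (Fin K) ℝ)
    (hUV : (Ubar, Vbar) ∈ MatrixCompletionVB.factorClass m p K r B)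
    (hM₀ : M₀ = Ubar * Vbarᵀ)
    (hM₀C : ∀ i j, |M₀ i j| ≤ C)
    (vb : (Fin n → MatrixCompletionVB.Obs m p) → Measure (MatrixCompletionVB.Param m p K))
    (hvb : ∀ x, MatrixCompletionVB.IsVBApprox a (MatrixCompletionVB.bChoice n m p K B) σ α x
      (vb x)) :
    ∫⁻ x, ∫⁻ θ, ENNReal.ofReal
        (MatrixCompletionVB.frobeniusSq (MatrixCompletionVB.clip C θ.toMatrix - M₀)
          / ((m : ℝ) * p)) ∂(vb x)
      ∂(MatrixCompletionVB.sampleLaw n σ M₀)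
    ≤ ENNReal.ofReal
        (8 * C ^ 2 * (1 + α) * (1 + 2 * a) * r * ((m : ℝ) + p) *
            (Real.log ((n : ℝ) * m * p) + MatrixCompletionVB.constC a
              + α * B / (2 * σ ^ 2 * m * p) * max 1 ((B / ((n : ℝ) * m * p)) ^ 3))
          / (n * (1 - Real.exp (2 * C ^ 2 * α * (α - 1) / σ ^ 2)))) := by
  have hm : 1 ≤ m := by omega
  have hp : 1 ≤ p := by omega
  have hb : 0 < MatrixCompletionVB.bChoice n m p K B := by
    have : 1 ≤ K := hr.trans hrK
    have : 0 < max m p := by omega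
    unfold MatrixCompletionVB.bChoice
    positivity
  obtain ⟨hU0, hUB, hV0, hVB⟩ := hUV
  obtain ⟨Uf, hUf⟩ : ∃ Uf : Fin m → Fin K → ℝ, ∀ i k, Uf i k = Ubar i k :=
    ⟨fun i k => Ubar i k, fun _ _ => rfl⟩
  obtain ⟨Vf, hVf⟩ : ∃ Vf : Fin p → Fin K → ℝ, ∀ j k, Vf j k = Vbar j k :=
    ⟨fun j k => Vbar j k, fun _ _ => rfl⟩
  obtain ⟨τ, hτ, v, hv, hac, hint, hkl, herr⟩ :=
    MatrixCompletionVB.exists_reference (Ub := Uf) (Vb := Vf) hn hr hrK hK ha hB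
      (fun i l hl => (hUf i l).trans (hU0 i l hl)) (fun i l => (hUf i l).symm ▸ hUB i l)
      (fun j l hl => (hVf j l).trans (hV0 j l hl)) (fun j l => (hVf j l).symm ▸ hVB j l)
  have hM₀' : ∀ i j, M₀ i j = ∑ k, Uf i k * Vf j k := by
    intro i j
    simp_rw [hM₀, Matrix.mul_apply, Matrix.transpose_apply, hUf, hVf]
  refine (MatrixCompletionVB.lintegral_risk_le τ Uf Vf hm hp hn hσ ha hb hα hα1 hC hv hM₀'
    hM₀C hac hint hvb).trans (ENNReal.ofReal_le_ofReal ?_)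
  have he : Real.exp (2 * C ^ 2 * α * (α - 1) / σ ^ 2) < 1 := by
    rw [Real.exp_lt_one_iff]
    refine div_neg_of_neg_of_pos (mul_neg_of_pos_of_neg (by positivity) (by linarith))
      (by positivity)
  -- `c * 4C²` equals `2C²α(1-α)/σ²`, the exponent in the announced denominator.
  have hcurv : MatrixCompletionVB.curv C (α * (1 - α) / (2 * σ ^ 2))
      = (1 - Real.exp (2 * C ^ 2 * α * (α - 1) / σ ^ 2)) / (4 * C ^ 2) := by
    rw [MatrixCompletionVB.curv]
    congr 3
    field_simp
    ring
  rw [hcurv]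
  set e := Real.exp (2 * C ^ 2 * α * (α - 1) / σ ^ 2)
  set L := ∫ θ, llr (MatrixCompletionVB.refLaw τ Uf Vf v)
    (MatrixCompletionVB.prior m p K a (MatrixCompletionVB.bChoice n m p K B)) θ
    ∂(MatrixCompletionVB.refLaw τ Uf Vf v)
  set Q := Real.log ((n : ℝ) * m * p) + MatrixCompletionVB.constC a
  set R := B * max 1 ((B / ((n : ℝ) * m * p)) ^ 3) with hR
  set W : ℝ := r * ((m : ℝ) + p) with hW
  have he' : 0 < 1 - e := sub_pos.2 he
  have hR0 : 0 < R := mul_pos hB (lt_max_of_lt_left one_pos)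
  have hW0 : 0 < W := by positivity
  have hL0 : 0 ≤ L := by
    have := MatrixCompletionVB.isProbabilityMeasure_prior (m := m) (p := p) (K := K) ha hb
    have h := InformationTheory.toReal_klDiv_of_measure_eq hac
      (by simp : MatrixCompletionVB.refLaw τ Uf Vf v Set.univ
        = MatrixCompletionVB.prior m p K a (MatrixCompletionVB.bChoice n m p K B) Set.univ)
    exact ENNReal.toReal_nonneg.trans_eq h
  -- The factor `1 + α` is slack. The sign of `Q` is not evident, so nonnegativity of the divergence
  -- `L` is what permits inserting it.
  have h1 : L ≤ (1 + α) * (2 * (1 + 2 * a) * W * Q) := by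
    have hkl' : L ≤ 2 * (1 + 2 * a) * W * Q := hkl.trans_eq (by rw [hW]; ring)
    nlinarith [hL0.trans hkl']
  have h2 : α / (2 * σ ^ 2) * (n * (((m : ℝ) * p)⁻¹
        * ∑ z, MatrixCompletionVB.entryErr Uf Vf v z))
      ≤ (1 + α) * (2 * (1 + 2 * a) * W * (α / (2 * σ ^ 2 * m * p) * R)) := by
    have h3 : α / (2 * σ ^ 2) * (n * (((m : ℝ) * p)⁻¹
        * ∑ z, MatrixCompletionVB.entryErr Uf Vf v z))
        = α / (2 * σ ^ 2 * m * p) * (n * ∑ z, MatrixCompletionVB.entryErr Uf Vf v z) := by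
      field_simp
    have h4 : 0 ≤ α / (2 * σ ^ 2 * m * p) := by positivity
    have h5 : 2 * W * R ≤ (1 + α) * (1 + 2 * a) * (2 * W * R) := by
      refine le_mul_of_one_le_left (by positivity) ?_
      exact one_le_mul_of_one_le_of_one_le (by linarith) (by linarith)
    rw [h3]
    refine (mul_le_mul_of_nonneg_left (herr.trans (le_trans (le_of_eq ?_) h5)) h4).trans_eq ?_
    · rw [hW]; ring
    · ring
  calc _ ≤ ((1 + α) * (2 * (1 + 2 * a) * W * Q)
        + (1 + α) * (2 * (1 + 2 * a) * W * (α / (2 * σ ^ 2 * m * p) * R)))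
          / (n * ((1 - e) / (4 * C ^ 2))) := by gcongr
    _ = _ := by
      rw [hW, hR]
      field_simp
      ring
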